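/- Let $R$ be a nonzero commutative unital ring and let $\mathscr G$ be an ample groupoid: a topological groupoid whose domain and range maps $d,r:\mathscr G\to\mathscr G^{(0)}$ are local homeomorphisms, whose unit space $\mathscr G^{(0)}$ is Hausdorff, and which has a basis of compact open bisections (open sets on which $d$ and $r$ are injective); $\mathscr G$ itself need not be Hausdorff. Let $R\mathscr G$ be the $R$-submodule of $R^{\mathscr G}$ spanned by the characteristic functions of compact open bisections, with the convolution product $(f_1*f_2)(g)=\sum_{d(h)=d(g)}f_1(gh^{-1})f_2(h)$. For $x\in\mathscr G^{(0)}$ let $\mathscr G_x^x=\{g: d(g)=x=r(g)\}$ be the isotropy group at $x$, $R\mathscr G_x^x$ its group ring, and $\mathcal O_x=r(d^{-1}(x))$ the orbit of $x$. Let $(x_\alpha)_{\alpha\in J}$ be any family of units that contains exactly one representative of each orbit, and write $\mathcal O_\alpha=\mathcal O_{x_\alpha}$. For a set $I$ and a unital ring $S$, $M_I(S)$ is the ring of $I\times I$ matrices over $S$ with only finitely many nonzero entries. A ring $A$ with local units is categorically left (right) noetherian if every finitely generated left (right) $A$-module $M$ with $AM=M$ (resp. $MA=M$) is noetherian, and locally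 left (right) noetherian if the unital ring $eAe$ is left (right) noetherian for every idempotent $e\in A$; similarly with "artinian" in place of "noetherian". Then the following are equivalent: 1. $R\mathscr G$ is categorically noetherian. 2. $R\mathscr G$ is locally noetherian. 3. $\mathscr G$ is discrete and $R\mathscr G_x^x$ is noetherian for every $x\in\mathscr G^{(0)}$. 4. $R\mathscr G\cong\bigoplus_{\alpha\in J}M_{\mathcal O_\alpha}(R\mathscr G_{x_\alpha}^{x_\alpha})$ and $R\mathscr G_{x_\alpha}^{x_\alpha}$ is noetherian for every $\alpha\in J$. Here each occurrence of "noetherian" may be read as "left noetherian" or as "right noetherian", and the isomorphism in (4) may be read as one of rings or as one of $R$-algebras; all the conditions so obtained are equivalent. The same holds with "artinian" in place of "noetherian" throughout. Moreover, whenever $R\mathscr G_x^x$ is left or right artinian for some $x\in\mathscr G^{(0)}$, the group $\mathscr G_x^x$ is finite and $R$ is artinian; in particular, in the artinian version of (4) all isotropy groups are finite and, if $\mathscr G$ is nonempty, $R$ is artinian. -/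

import Mathlib

open CategoryTheory

namespace AmpleAlg

/-! ## Topological, etale and ample groupoids

A groupoid is a category `C` all of whose morphisms are isomorphisms.  Its set of arrows is
`Arrow C`; the domain of `g : Arrow C` is `g.left`, its range is `g.right`, and the product `g h`
of arrows with `d(g) = r(h)` is the composite "first `h`, then `g`".  An object `x` is identified
with the unit `𝟙 x`. -/

section Groupoids

universe v u

variable {C : Type u} [Groupoid.{v} C]

/-- The product `g h` of two arrows with `d(g) = r(h)`. -/
def arrowMul (g h : Arrow C) (e : g.left = h.right) : Arrow C :=
  Arrow.mk (h.hom ≫ eqToHom e.symm ≫ g.hom)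

/-- The inverse of an arrow. -/
def arrowInv (g : Arrow C) : Arrow C := Arrow.mk (Groupoid.inv g.hom)

variable (C) in
/-- An etale groupoid: a topological groupoid (the set of units carries the subspace topology, and
multiplication and inversion are continuous) whose domain and range maps are local
homeomorphisms. -/
class EtaleGroupoid [TopologicalSpace C] [TopologicalSpace (Arrow C)] : Prop where
  isInducing_unit : Topology.IsInducing fun x : C => Arrow.mk (𝟙 x)
  continuous_mul : Continuous fun p : {p : Arrow C × Arrow C // p.1.left = p.2.right} =>
    arrowMul p.1.1 p.1.2 p.2
  continuous_inv : Continuous fun g : Arrow C => arrowInv g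
  isLocalHomeomorph_dom : IsLocalHomeomorph fun g : Arrow C => g.left
  isLocalHomeomorph_ran : IsLocalHomeomorph fun g : Arrow C => g.right

/-- A compact open bisection: a compact open set of arrows on which the domain map and the range
map are injective. -/
structure IsCompactOpenBisection [TopologicalSpace (Arrow C)] (U : Set (Arrow C)) : Prop where
  isCompact : IsCompact U
  isOpen : IsOpen U
  injOn_dom : Set.InjOn (fun g : Arrow C => g.left) U
  injOn_ran : Set.InjOn (fun g : Arrow C => g.right) U

variable (C) in
/-- An ample groupoid: an etale groupoid with Hausdorff unit space whose topology has a basis of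
compact open bisections.  (Local compactness of the arrow space and of the unit space follows; the
arrow space need not be Hausdorff.) -/
class AmpleGroupoid [TopologicalSpace C] [TopologicalSpace (Arrow C)] : Prop
    extends EtaleGroupoid C where
  t2Space_unit : T2Space C
  isTopologicalBasis :
    TopologicalSpace.IsTopologicalBasis {U : Set (Arrow C) | IsCompactOpenBisection U}

/-- The orbit of the unit `x`: all units `y` that admit an arrow `x ⟶ y`. -/
def orbit (x : C) : Set C := {y | Nonempty (x ⟶ y)}

/-- The product of two sets of arrows. -/
def setMul (U V : Set (Arrow C)) : Set (Arrow C) :=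
  {a | ∃ g ∈ U, ∃ h ∈ V, ∃ e : g.left = h.right, arrowMul g h e = a}

theorem arrowInv_mul_cancel (g h : Arrow C) (e : g.left = h.right) :
    ∃ e', arrowMul (arrowInv g) (arrowMul g h e) e' = h := by
  obtain ⟨x, y, g, rfl⟩ := g.mk_surjective
  obtain ⟨z, w, h, rfl⟩ := h.mk_surjective
  have e2 : x = w := e
  subst e2
  refine ⟨rfl, ?_⟩
  simp [arrowMul, arrowInv]

theorem mul_arrowInv_cancel (u g : Arrow C) (e : (arrowInv u).left = g.right) :
    ∃ e', arrowMul u (arrowMul (arrowInv u) g e) e' = g := by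
  obtain ⟨x, y, u, rfl⟩ := u.mk_surjective
  obtain ⟨z, w, g, rfl⟩ := g.mk_surjective
  have e2 : y = w := e
  subst e2
  refine ⟨rfl, ?_⟩
  simp [arrowMul, arrowInv]

theorem isOpen_setMul [TopologicalSpace C] [TopologicalSpace (Arrow C)] [EtaleGroupoid C]
    {U V : Set (Arrow C)} (hU : IsOpen U) (hV : IsOpen V) : IsOpen (setMul U V) := by
  have hr : Continuous fun g : Arrow C => g.right :=
    (EtaleGroupoid.isLocalHomeomorph_ran (C := C)).continuous
  have hro : IsOpenMap fun g : Arrow C => g.right :=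
    (EtaleGroupoid.isLocalHomeomorph_ran (C := C)).isOpenMap
  let F := {p : Arrow C × Arrow C // p.2.right = p.1.right}
  have hq : Continuous fun p : F => arrowMul (arrowInv p.1.2) p.1.1 p.2 := by
    refine (EtaleGroupoid.continuous_mul (C := C)).comp (f := fun p : F =>
      (⟨(arrowInv p.1.2, p.1.1), p.2⟩ :
        {p : Arrow C × Arrow C // p.1.left = p.2.right})) ?_
    exact Continuous.subtype_mk
      (((EtaleGroupoid.continuous_inv (C := C)).comp
        (continuous_snd.comp continuous_subtype_val)).prodMk
        (continuous_fst.comp continuous_subtype_val)) _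
  rw [isOpen_iff_mem_nhds]
  rintro a ⟨u, hu, h, hh, e, rfl⟩
  obtain ⟨e', he'⟩ := arrowInv_mul_cancel u h e
  have hopen := hV.preimage hq
  obtain ⟨W, hW, hWeq⟩ := isOpen_induced_iff.1 hopen
  have hmem : (arrowMul u h e, u) ∈ W := by
    have : (⟨(arrowMul u h e, u), e'⟩ : F) ∈ Subtype.val ⁻¹' W := by
      rw [hWeq]
      change arrowMul (arrowInv u) (arrowMul u h e) e' ∈ V
      rw [he']; exact hh
    exact this
  obtain ⟨A, B, hA, hB, haA, huB, hAB⟩ := isOpen_prod_iff.1 hW _ _ hmem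
  refine Filter.mem_of_superset ((hA.inter ((hro _ (hB.inter hU)).preimage hr)).mem_nhds
    ⟨haA, u, ⟨huB, hu⟩, e'⟩) ?_
  rintro g ⟨hgA, u', ⟨hu'B, hu'U⟩, hu'⟩
  have h2 : (⟨(g, u'), hu'⟩ : F) ∈ (fun p : F => arrowMul (arrowInv p.1.2) p.1.1 p.2) ⁻¹' V := by
    rw [← hWeq]; exact hAB ⟨hgA, hu'B⟩
  obtain ⟨e2, h3⟩ := mul_arrowInv_cancel u' g hu'
  exact ⟨u', hu'U, _, h2, e2, h3⟩

theorem isCompact_setMul [TopologicalSpace C] [TopologicalSpace (Arrow C)] [AmpleGroupoid C]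
    {U V : Set (Arrow C)} (hU : IsCompact U) (hV : IsCompact V) : IsCompact (setMul U V) := by
  have hd : Continuous fun g : Arrow C => g.left :=
    (EtaleGroupoid.isLocalHomeomorph_dom (C := C)).continuous
  have hr : Continuous fun g : Arrow C => g.right :=
    (EtaleGroupoid.isLocalHomeomorph_ran (C := C)).continuous
  have : T2Space C := AmpleGroupoid.t2Space_unit
  have hcl : IsClosed {p : Arrow C × Arrow C | p.1.left = p.2.right} :=
    isClosed_eq (hd.comp continuous_fst) (hr.comp continuous_snd)
  have hK : IsCompact ((Subtype.val : {p : Arrow C × Arrow C // p.1.left = p.2.right} → _) ⁻¹'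
      (U ×ˢ V)) :=
    hcl.isClosedEmbedding_subtypeVal.isCompact_preimage (hU.prod hV)
  have heq : setMul U V = (fun p : {p : Arrow C × Arrow C // p.1.left = p.2.right} =>
      arrowMul p.1.1 p.1.2 p.2) '' (Subtype.val ⁻¹' (U ×ˢ V)) := by
    ext a
    constructor
    · rintro ⟨g, hg, h, hh, e, rfl⟩
      exact ⟨⟨(g, h), e⟩, ⟨hg, hh⟩, rfl⟩
    · rintro ⟨⟨⟨g, h⟩, e⟩, ⟨hg, hh⟩, rfl⟩
      exact ⟨g, hg, h, hh, e, rfl⟩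
  rw [heq]
  exact hK.image EtaleGroupoid.continuous_mul

theorem IsCompactOpenBisection.setMul [TopologicalSpace C] [TopologicalSpace (Arrow C)]
    [AmpleGroupoid C] {U V : Set (Arrow C)} (hU : IsCompactOpenBisection U)
    (hV : IsCompactOpenBisection V) : IsCompactOpenBisection (setMul U V) where
  isCompact := isCompact_setMul hU.isCompact hV.isCompact
  isOpen := isOpen_setMul hU.isOpen hV.isOpen
  injOn_dom := by
    rintro a ⟨g, hg, h, hh, e, rfl⟩ b ⟨g', hg', h', hh', e', rfl⟩ hab
    have h1 : h = h' := hV.injOn_dom hh hh' hab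
    subst h1
    have h2 : g = g' := hU.injOn_dom hg hg' (e.trans e'.symm)
    subst h2
    rfl
  injOn_ran := by
    rintro a ⟨g, hg, h, hh, e, rfl⟩ b ⟨g', hg', h', hh', e', rfl⟩ hab
    have h1 : g = g' := hU.injOn_ran hg hg' hab
    subst h1
    have h2 : h = h' := hV.injOn_ran hh hh' (e.symm.trans e')
    subst h2
    rfl

end Groupoids

/-! ## The groupoid algebra -/

section Algebra

universe w v u

variable {R : Type w} [CommRing R] {C : Type u} [Groupoid.{v} C]

/-- Convolution: `(f ∗ k)(g) = ∑ f(g h⁻¹) k(h)`, the sum being over all arrows `h` with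
`d(h) = d(g)`. -/
noncomputable def convolution (f k : Arrow C → R) (g : Arrow C) : R :=
  ∑ᶠ h : Σ z : C, (g.left ⟶ z), f (Arrow.mk (Groupoid.inv h.2 ≫ g.hom)) * k (Arrow.mk h.2)

/-- A function that has finite support on every fibre of the domain map. -/
def FibreFinite (f : Arrow C → R) : Prop :=
  ∀ x : C, {h : Σ z : C, (x ⟶ z) | f (Arrow.mk h.2) ≠ 0}.Finite

theorem FibreFinite.zero : FibreFinite (0 : Arrow C → R) := by
  intro x; simp

theorem FibreFinite.add {f k : Arrow C → R} (hf : FibreFinite f) (hk : FibreFinite k) :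
    FibreFinite (f + k) := by
  intro x
  refine ((hf x).union (hk x)).subset ?_
  intro h hh
  by_contra hc
  simp only [Set.mem_union, Set.mem_ofPred_eq, not_or, not_not] at hc
  exact hh (by simp [hc.1, hc.2])

theorem FibreFinite.smul {f : Arrow C → R} (r : R) (hf : FibreFinite f) :
    FibreFinite (r • f) := by
  intro x
  refine (hf x).subset ?_
  intro h hh hc
  exact hh (by simp [hc])

theorem convolution_support {f k : Arrow C → R} (hk : FibreFinite k) (g : Arrow C) :
    (Function.support fun h : Σ z : C, (g.left ⟶ z) =>
      f (Arrow.mk (Groupoid.inv h.2 ≫ g.hom)) * k (Arrow.mk h.2)).Finite :=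
  (hk g.left).subset fun _ hh hc => hh (by simp [hc])

theorem convolution_add {f k l : Arrow C → R} (hk : FibreFinite k) (hl : FibreFinite l) :
    convolution f (k + l) = convolution f k + convolution f l := by
  funext g
  simp only [convolution, Pi.add_apply, mul_add]
  exact finsum_add_distrib (convolution_support hk g) (convolution_support hl g)

theorem add_convolution {f k l : Arrow C → R} (hl : FibreFinite l) :
    convolution (f + k) l = convolution f l + convolution k l := by
  funext g
  simp only [convolution, Pi.add_apply, add_mul]
  exact finsum_add_distrib (convolution_support hl g) (convolution_support hl g)

theorem smul_convolution {f k : Arrow C → R} (r : R) (hk : FibreFinite k) :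
    convolution (r • f) k = r • convolution f k := by
  funext g
  simp only [convolution, Pi.smul_apply, smul_eq_mul, mul_assoc]
  exact (mul_finsum' _ _ (convolution_support hk g)).symm

theorem convolution_smul {f k : Arrow C → R} (r : R) (hk : FibreFinite k) :
    convolution f (r • k) = r • convolution f k := by
  funext g
  simp only [convolution, Pi.smul_apply, smul_eq_mul, mul_left_comm _ r]
  exact (mul_finsum' _ _ (convolution_support hk g)).symm

theorem convolution_zero (f : Arrow C → R) : convolution f 0 = 0 := by
  funext g; simp [convolution]

theorem zero_convolution (f : Arrow C → R) : convolution 0 f = 0 := by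
  funext g; simp [convolution]

/-- Composition with a fixed arrow, as a bijection between fibres of the domain map. -/
def fibreEquiv {x z : C} (h : x ⟶ z) : (Σ w : C, (z ⟶ w)) ≃ (Σ w : C, (x ⟶ w)) where
  toFun m := ⟨m.1, h ≫ m.2⟩
  invFun n := ⟨n.1, Groupoid.inv h ≫ n.2⟩
  left_inv m := by simp
  right_inv n := by simp

theorem convolution_assoc {f k l : Arrow C → R} (hk : FibreFinite k) (hl : FibreFinite l) :
    convolution (convolution f k) l = convolution f (convolution k l) := by
  funext g
  have hH := hl g.left
  have hsub : ∀ F : (Σ z : C, (g.left ⟶ z)) → R,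
      (∑ᶠ h : Σ z : C, (g.left ⟶ z), F h * l (Arrow.mk h.2)) =
        ∑ h ∈ hH.toFinset, F h * l (Arrow.mk h.2) := by
    intro F
    refine finsum_eq_sum_of_support_subset _ ?_
    intro h hh
    simp only [Set.Finite.coe_toFinset, Set.mem_ofPred_eq]
    intro hc
    exact hh (by simp [hc])
  have hR : ∀ n : Σ z : C, (g.left ⟶ z), convolution k l (Arrow.mk n.2) =
      ∑ h ∈ hH.toFinset, k (Arrow.mk (Groupoid.inv h.2 ≫ n.2)) * l (Arrow.mk h.2) :=
    fun n => hsub fun h => k (Arrow.mk (Groupoid.inv h.2 ≫ n.2))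
  have hfin : ∀ h : Σ z : C, (g.left ⟶ z),
      {n : Σ z : C, (g.left ⟶ z) | k (Arrow.mk (Groupoid.inv h.2 ≫ n.2)) ≠ 0}.Finite := by
    intro h
    exact (hk h.1).preimage (f := (fibreEquiv h.2).symm) (fibreEquiv h.2).symm.injective.injOn
  calc convolution (convolution f k) l g
      = ∑ h ∈ hH.toFinset,
          convolution f k (Arrow.mk (Groupoid.inv h.2 ≫ g.hom)) * l (Arrow.mk h.2) := hsub _
    _ = ∑ h ∈ hH.toFinset, ∑ᶠ n : Σ z : C, (g.left ⟶ z),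
          f (Arrow.mk (Groupoid.inv n.2 ≫ g.hom)) *
            (k (Arrow.mk (Groupoid.inv h.2 ≫ n.2)) * l (Arrow.mk h.2)) := by
        refine Finset.sum_congr rfl fun h _ => ?_
        have hs : (Function.support fun n : Σ z : C, (g.left ⟶ z) =>
            f (Arrow.mk (Groupoid.inv n.2 ≫ g.hom)) *
              k (Arrow.mk (Groupoid.inv h.2 ≫ n.2))).Finite :=
          (hfin h).subset fun n hn hc => hn (by simp only [hc, mul_zero])
        simp only [← mul_assoc]
        rw [← finsum_mul' _ _ hs]
        congr 1
        rw [← finsum_comp_equiv (fibreEquiv h.2)]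
        simp only [convolution]
        refine finsum_congr fun m => ?_
        simp [fibreEquiv]
    _ = ∑ᶠ n : Σ z : C, (g.left ⟶ z), ∑ h ∈ hH.toFinset,
          f (Arrow.mk (Groupoid.inv n.2 ≫ g.hom)) *
            (k (Arrow.mk (Groupoid.inv h.2 ≫ n.2)) * l (Arrow.mk h.2)) := by
        refine (finsum_sum_comm _ _ fun h _ => ?_).symm
        exact (hfin h).subset fun n hn hc => hn (by simp only [hc, mul_zero, zero_mul])
    _ = convolution f (convolution k l) g := by
        simp only [convolution]
        refine finsum_congr fun n => ?_
        rw [← Finset.mul_sum, ← hR]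
        rfl

variable [TopologicalSpace (Arrow C)]

variable (R C) in
/-- The underlying module of the groupoid algebra: the `R`-submodule of all functions on arrows
that is spanned by the characteristic functions of compact open bisections. -/
def groupoidSubmodule : Submodule R (Arrow C → R) :=
  Submodule.span R {f | ∃ U : Set (Arrow C), IsCompactOpenBisection U ∧ f = U.indicator 1}

theorem IsCompactOpenBisection.fibreFinite {U : Set (Arrow C)} (hU : IsCompactOpenBisection U) :
    FibreFinite (U.indicator (1 : Arrow C → R)) := by
  intro x
  refine Set.Subsingleton.finite ?_
  rintro ⟨z, h⟩ hh ⟨z', h'⟩ hh'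
  have h1 : Arrow.mk h ∈ U := by
    by_contra hc; exact hh (Set.indicator_of_notMem hc _)
  have h2 : Arrow.mk h' ∈ U := by
    by_contra hc; exact hh' (Set.indicator_of_notMem hc _)
  have := hU.injOn_dom h1 h2 rfl
  cases this
  rfl

theorem fibreFinite_of_mem {f : Arrow C → R} (hf : f ∈ groupoidSubmodule R C) :
    FibreFinite f := by
  induction hf using Submodule.span_induction with
  | mem f hf => obtain ⟨U, hU, rfl⟩ := hf; exact hU.fibreFinite
  | zero => exact FibreFinite.zero
  | add f k _ _ hf hk => exact hf.add hk
  | smul r f _ hf => exact hf.smul r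

theorem convolution_indicator {U V : Set (Arrow C)}
    (hV : IsCompactOpenBisection V) :
    convolution (U.indicator (1 : Arrow C → R)) (V.indicator 1) = (setMul U V).indicator 1 := by
  classical
  funext g
  by_cases hg : g ∈ setMul U V
  · rw [Set.indicator_of_mem hg]
    obtain ⟨a, ha, b, hb, e, rfl⟩ := hg
    obtain ⟨x, y, a, rfl⟩ := a.mk_surjective
    obtain ⟨z, w, b, rfl⟩ := b.mk_surjective
    have e2 : x = w := e
    subst e2
    refine (finsum_eq_single _ (⟨_, b⟩ : Σ w : C, (z ⟶ w)) ?_).trans ?_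
    rotate_left
    · have h1 : Arrow.mk (Groupoid.inv b ≫ (arrowMul (Arrow.mk a) (Arrow.mk b) rfl).hom) ∈ U := by
        have : Arrow.mk (Groupoid.inv b ≫ (arrowMul (Arrow.mk a) (Arrow.mk b) rfl).hom) =
            Arrow.mk a := by simp [arrowMul]
        rw [this]; exact ha
      have h2 : Arrow.mk b ∈ V := hb
      exact (congrArg₂ (· * ·) (Set.indicator_of_mem h1 _) (Set.indicator_of_mem h2 _)).trans
        (one_mul _)
    · rintro ⟨w, h⟩ hne
      have h2 : Arrow.mk h ∉ V := by
        intro hc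
        have := hV.injOn_dom hc hb rfl
        cases this
        exact hne rfl
      exact (congrArg _ (Set.indicator_of_notMem h2 _)).trans (mul_zero _)
  · rw [Set.indicator_of_notMem hg, convolution]
    refine (finsum_congr fun h => ?_).trans finsum_zero
    by_cases h2 : Arrow.mk h.2 ∈ V
    · have h1 : Arrow.mk (Groupoid.inv h.2 ≫ g.hom) ∉ U := by
        intro hc
        refine hg ⟨_, hc, _, h2, rfl, ?_⟩
        simp [arrowMul]
      rw [Set.indicator_of_notMem h1, zero_mul]
    · rw [Set.indicator_of_notMem h2, mul_zero]

variable [TopologicalSpace C] [AmpleGroupoid C]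

theorem convolution_mem {f k : Arrow C → R} (hf : f ∈ groupoidSubmodule R C)
    (hk : k ∈ groupoidSubmodule R C) : convolution f k ∈ groupoidSubmodule R C := by
  have hkf := fibreFinite_of_mem hk
  induction hf using Submodule.span_induction with
  | zero => rw [zero_convolution]; exact zero_mem _
  | add f₁ f₂ _ _ h₁ h₂ => rw [add_convolution hkf]; exact add_mem h₁ h₂
  | smul r f _ h => rw [smul_convolution r hkf]; exact Submodule.smul_mem _ r h
  | mem f hf =>
    obtain ⟨U, hU, rfl⟩ := hf
    clear hkf
    induction hk using Submodule.span_induction with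
    | zero => rw [convolution_zero]; exact zero_mem _
    | add k₁ k₂ hk₁ hk₂ h₁ h₂ =>
      rw [convolution_add (fibreFinite_of_mem hk₁) (fibreFinite_of_mem hk₂)]
      exact add_mem h₁ h₂
    | smul r k hk h =>
      rw [convolution_smul r (fibreFinite_of_mem hk)]; exact Submodule.smul_mem _ r h
    | mem k hk =>
      obtain ⟨V, hV, rfl⟩ := hk
      rw [convolution_indicator hV]
      exact Submodule.subset_span ⟨_, hU.setMul hV, rfl⟩

variable (R C) in
/-- The groupoid algebra `RG` of an ample groupoid. -/
def GroupoidAlgebra : Type (max w v u) := ↥(groupoidSubmodule R C)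

namespace GroupoidAlgebra

noncomputable instance : AddCommGroup (GroupoidAlgebra R C) :=
  inferInstanceAs (AddCommGroup ↥(groupoidSubmodule R C))

noncomputable instance : Module R (GroupoidAlgebra R C) :=
  inferInstanceAs (Module R ↥(groupoidSubmodule R C))

/-- The multiplication of the groupoid algebra is convolution. -/
noncomputable instance : Mul (GroupoidAlgebra R C) :=
  ⟨fun f k => ⟨convolution f.1 k.1, convolution_mem f.2 k.2⟩⟩

noncomputable instance : NonUnitalRing (GroupoidAlgebra R C) where
  left_distrib _ k l := Subtype.ext (convolution_add (fibreFinite_of_mem k.2)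
    (fibreFinite_of_mem l.2))
  right_distrib _ _ l := Subtype.ext (add_convolution (fibreFinite_of_mem l.2))
  zero_mul f := Subtype.ext (zero_convolution f.1)
  mul_zero f := Subtype.ext (convolution_zero f.1)
  mul_assoc _ k l := Subtype.ext (convolution_assoc (fibreFinite_of_mem k.2)
    (fibreFinite_of_mem l.2))

end GroupoidAlgebra

end Algebra

/-! ## Matrices with finitely many nonzero entries, and direct sums of rings -/

section Matrices

universe u v w

/-- The additive group of `J × J` matrices over `S` with only finitely many nonzero entries. -/
def finMatrixSubgroup (J : Type u) (S : Type v) [Ring S] : AddSubgroup (J → J → S) where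
  carrier := {M | {p : J × J | M p.1 p.2 ≠ 0}.Finite}
  zero_mem' := by simp
  add_mem' := by
    intro M N hM hN
    refine (Set.Finite.union hM hN).subset fun p hp => ?_
    by_contra hc
    simp only [Set.mem_union, Set.mem_ofPred_eq, not_or, not_not] at hc
    exact hp (by simp [hc.1, hc.2])
  neg_mem' := by
    intro M hM
    simpa using hM

/-- The ring `M_J(S)` of `J × J` matrices over `S` with only finitely many nonzero entries. -/
def FinMatrix (J : Type u) (S : Type v) [Ring S] : Type (max u v) := ↥(finMatrixSubgroup J S)

namespace FinMatrix

variable {J : Type u} {S : Type v} [Ring S]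

/-- The product of two matrices. -/
noncomputable def mulFun (M N : J → J → S) : J → J → S := fun i k => ∑ᶠ j, M i j * N j k

theorem support_row (M : FinMatrix J S) (i : J) : {j | M.1 i j ≠ 0}.Finite :=
  Set.Finite.preimage (f := fun j => (i, j)) (fun _ _ _ _ h => (Prod.mk.inj h).2) M.2

theorem support_mul (M : FinMatrix J S) (N : J → J → S) (i k : J) :
    (Function.support fun j => M.1 i j * N j k).Finite :=
  (M.support_row i).subset fun j hj hc => hj (by simp [hc])

theorem mulFun_mem (M N : FinMatrix J S) : mulFun M.1 N.1 ∈ finMatrixSubgroup J S := by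
  refine ((Set.Finite.image Prod.fst M.2).prod (Set.Finite.image Prod.snd N.2)).subset ?_
  rintro ⟨i, k⟩ hik
  obtain ⟨j, hj⟩ : ∃ j, M.1 i j * N.1 j k ≠ 0 := by
    by_contra hc
    push Not at hc
    exact hik (by simp [mulFun, hc])
  refine ⟨⟨(i, j), ?_, rfl⟩, ⟨(j, k), ?_, rfl⟩⟩
  · exact fun h => hj (by rw [h, zero_mul])
  · exact fun h => hj (by rw [h, mul_zero])

noncomputable instance : AddCommGroup (FinMatrix J S) :=
  inferInstanceAs (AddCommGroup ↥(finMatrixSubgroup J S))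

/-- Matrix multiplication. -/
noncomputable instance : Mul (FinMatrix J S) := ⟨fun M N => ⟨mulFun M.1 N.1, mulFun_mem M N⟩⟩

/-- Entrywise scalar multiplication. -/
instance {R : Type w} [CommRing R] [Module R S] : SMul R (FinMatrix J S) :=
  ⟨fun r M => ⟨fun i j => r • M.1 i j, by
    refine Set.Finite.subset M.2 fun p hp hc => hp ?_
    simp [hc]⟩⟩

theorem mulFun_assoc (M N P : FinMatrix J S) :
    mulFun (mulFun M.1 N.1) P.1 = mulFun M.1 (mulFun N.1 P.1) := by
  funext i l
  have hT := M.support_row i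
  have hN : ∀ k, mulFun M.1 N.1 i k = ∑ j ∈ hT.toFinset, M.1 i j * N.1 j k := by
    intro k
    refine finsum_eq_sum_of_support_subset _ ?_
    intro j hj
    simp only [Set.Finite.coe_toFinset, Set.mem_ofPred_eq]
    exact fun hc => hj (by simp [hc])
  have hR : mulFun M.1 (mulFun N.1 P.1) i l =
      ∑ j ∈ hT.toFinset, M.1 i j * mulFun N.1 P.1 j l := by
    refine finsum_eq_sum_of_support_subset _ ?_
    intro j hj
    simp only [Set.Finite.coe_toFinset, Set.mem_ofPred_eq]
    exact fun hc => hj (by simp [hc])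
  rw [hR]
  simp only [mulFun] at hN ⊢
  simp only [hN, Finset.sum_mul]
  rw [finsum_sum_comm]
  · refine Finset.sum_congr rfl fun j _ => ?_
    rw [mul_finsum' _ _ (support_mul N P.1 j l)]
    exact finsum_congr fun k => mul_assoc _ _ _
  · intro j _
    exact (N.support_row j).subset fun k hk hc => hk (by simp [hc])

noncomputable instance : NonUnitalRing (FinMatrix J S) where
  left_distrib M N P := Subtype.ext <| by
    funext i k
    refine (finsum_congr fun j => mul_add _ _ _).trans ?_
    exact finsum_add_distrib (support_mul M N.1 i k) (support_mul M P.1 i k)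
  right_distrib M N P := Subtype.ext <| by
    funext i k
    refine (finsum_congr fun j => add_mul _ _ _).trans ?_
    exact finsum_add_distrib (support_mul M P.1 i k) (support_mul N P.1 i k)
  zero_mul M := Subtype.ext <| by
    funext i k
    exact (finsum_congr fun j => zero_mul _).trans finsum_zero
  mul_zero M := Subtype.ext <| by
    funext i k
    exact (finsum_congr fun j => mul_zero _).trans finsum_zero
  mul_assoc M N P := Subtype.ext (mulFun_assoc M N P)

end FinMatrix

/-- The direct sum `⨁ Aⱼ` of a family of rings, with componentwise operations: the families with
only finitely many nonzero members. -/
def ringDirectSum {J : Type u} (A : J → Type v) [∀ j, NonUnitalRing (A j)] :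
    NonUnitalSubring (∀ j, A j) where
  carrier := {a | {j | a j ≠ 0}.Finite}
  zero_mem' := by simp
  add_mem' := by
    intro a b ha hb
    refine (Set.Finite.union ha hb).subset fun j hj => ?_
    by_contra hc
    simp only [Set.mem_union, Set.mem_ofPred_eq, not_or, not_not] at hc
    exact hj (by simp [hc.1, hc.2])
  neg_mem' := by
    intro a ha
    simpa using ha
  mul_mem' := by
    intro a b ha hb
    exact Set.Finite.subset ha fun j hj hc => hj (by simp [hc])

end Matrices

/-! ## Chain conditions for rings that need not be unital -/

section ChainConditions

universe u v

/-- A left module over a ring that need not be unital. -/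
class LeftModule (A : Type u) [NonUnitalRing A] (M : Type v) [AddCommGroup M]
    extends SMul A M where
  smul_add : ∀ (a : A) (m n : M), a • (m + n) = a • m + a • n
  add_smul : ∀ (a b : A) (m : M), (a + b) • m = a • m + b • m
  mul_smul : ∀ (a b : A) (m : M), (a * b) • m = a • (b • m)

variable (A : Type u) [NonUnitalRing A] (M : Type v) [AddCommGroup M] [LeftModule A M]

/-- The submodules of a left module, ordered by inclusion. -/
abbrev LeftSubmodule : Type v := {N : AddSubgroup M // ∀ (a : A), ∀ m ∈ N, a • m ∈ N}

/-- A left module `M` is unitary if `A M = M`: every element is a finite sum of elements `a m`. -/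
def IsUnitary : Prop := AddSubgroup.closure {x : M | ∃ (a : A) (m : M), x = a • m} = ⊤

/-- A left module is finitely generated if some finite subset lies in no proper submodule. -/
def IsFinitelyGenerated : Prop :=
  ∃ s : Finset M, ∀ N : LeftSubmodule A M, (s : Set M) ⊆ N.1 → N.1 = ⊤

/-- The ascending chain condition on submodules. -/
def IsNoetherianModule : Prop := WellFoundedGT (LeftSubmodule A M)

/-- The descending chain condition on submodules. -/
def IsArtinianModule : Prop := WellFoundedLT (LeftSubmodule A M)

/-- Every finitely generated unitary left module is noetherian.  (Every such module over a ring with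
local units is a quotient of some `Aⁿ`, so modules in the universe of `A` suffice.)  The
corresponding condition on right modules is the condition on left modules over `Aᵐᵒᵖ`. -/
def CategoricallyNoetherian : Prop :=
  ∀ (M : Type u) [AddCommGroup M] [LeftModule A M],
    IsUnitary A M → IsFinitelyGenerated A M → IsNoetherianModule A M

/-- Every finitely generated unitary left module is artinian. -/
def CategoricallyArtinian : Prop :=
  ∀ (M : Type u) [AddCommGroup M] [LeftModule A M],
    IsUnitary A M → IsFinitelyGenerated A M → IsArtinianModule A M

/-- The unital ring `e A e` is left noetherian for every idempotent `e`. -/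
def LocallyNoetherian : Prop :=
  ∀ (e : A) (he : IsIdempotentElem e), IsNoetherianRing he.Corner

/-- The unital ring `e A e` is left artinian for every idempotent `e`. -/
def LocallyArtinian : Prop :=
  ∀ (e : A) (he : IsIdempotentElem e), IsArtinianRing he.Corner

end ChainConditions

/-! ## The matrix decomposition -/

section Decomposition

universe w v u t

variable (R : Type w) [CommRing R] {C : Type u} [Groupoid.{v} C]

/-- The group ring over `R` of the isotropy group at `x`. -/
abbrev IsotropyRing (x : C) : Type (max w v) := MonoidAlgebra R (End x)

/-- The direct sum, over the members `x j` of a family of units, of the rings of finitely supported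
matrices indexed by the orbit of `x j` with entries in the isotropy group ring at `x j`. -/
abbrev OrbitMatrixSum {J : Type t} (x : J → C) : Type (max t w v u) :=
  ↥(ringDirectSum fun j => FinMatrix (orbit (x j)) (IsotropyRing R (x j)))

/-- The `R`-action on the direct sum is entrywise. -/
noncomputable instance {J : Type t} (x : J → C) : SMul R (OrbitMatrixSum R x) :=
  ⟨fun r a => ⟨fun j => r • a.1 j, by
    refine Set.Finite.subset a.2 fun j hj hc => hj ?_
    refine (congrArg (r • ·) hc).trans (Subtype.ext ?_)
    funext i k
    exact smul_zero r⟩⟩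

end Decomposition

end AmpleAlg

open AmpleAlg

namespace AmpleAlg

/-! Inversion of arrows identifies the groupoid algebra `A` with its opposite
(`GroupoidAlgebra.opEquiv`), and inversion in a group does the same for group rings. The left and
right conditions therefore coincide, and all arguments use left modules.

Categorical implies local: for an idempotent `e`, left ideals of `e A e` embed strictly
monotonically into the submodules of the cyclic unitary module `A e` (`strictMono_cornerExtension`).

Local implies discrete: inside a compact open set `K` of units, shrinking the compact open
neighbourhoods of a unit `x` enlarges their left annihilators in the corner of the indicator of `K`.
A maximal annihilator is reached only at the neighbourhood `{x}`, so units are isolated, and the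
domain map, a local homeomorphism, carries discreteness to all arrows. Artinian corners are
noetherian by Hopkins–Levitzki, so this covers both cases.

For discrete groupoids `A` consists of the finitely supported functions. An arrow amounts to an
orbit, a range, a domain and an isotropy element, and in these coordinates convolution is matrix
multiplication over group rings (`GroupoidAlgebra.matrixEquiv`). The coefficient rings are images of
the corners at diagonal matrix units, hence inherit the local chain condition.

Matrix decomposition implies categorical: this is a Morita argument. A finitely generated unitary
module `M` involves only finitely many summands. If `e` is the sum of one diagonal matrix unit from
each of these, then `M = A e M`, so `N ↦ e N` is strictly monotone on submodules, and `e M` is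
finitely generated over a finite product of coefficient rings.

Finiteness of isotropy: `exists_mul_mem_fg` finds a nonzero `g` in an artinian group ring such that
all products `g a` lie in one finitely generated `R`-module. All these products are then supported
in one finite set, and translating a point of the support of `g` embeds the group into that set. -/

theorem mem_of_eq_of_mem {α S : Type*} [SetLike S α] {a b : α} {s : S} (h : a = b) (hb : b ∈ s) :
    a ∈ s := h ▸ hb

/-! ## Modules over rings that need not be unital -/

section LeftModules

variable {A : Type*} [NonUnitalRing A] {M : Type*} [AddCommGroup M] [LeftModule A M]

variable (M) in
/-- The action of an element of the ring on a module, as an additive map. -/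
def LeftModule.actHom (a : A) : M →+ M :=
  AddMonoidHom.mk' (a • ·) (LeftModule.smul_add a)

/-- The action on a fixed element of a module, as an additive map from the ring. -/
def LeftModule.orbitHom (m : M) : A →+ M :=
  AddMonoidHom.mk' (· • m) fun a b => LeftModule.add_smul a b m

theorem LeftModule.smul_zero (a : A) : a • (0 : M) = 0 := map_zero (LeftModule.actHom M a)

theorem LeftModule.zero_smul (m : M) : (0 : A) • m = 0 := map_zero (LeftModule.orbitHom (A := A) m)

theorem LeftModule.smul_neg (a : A) (m : M) : a • -m = -(a • m) :=
  map_neg (LeftModule.actHom M a) m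

theorem LeftModule.smul_sum (a : A) {κ : Type*} (s : Finset κ) (f : κ → M) :
    a • ∑ k ∈ s, f k = ∑ k ∈ s, a • f k := map_sum (LeftModule.actHom M a) f s

theorem LeftModule.sum_smul (m : M) {κ : Type*} (s : Finset κ) (f : κ → A) :
    (∑ k ∈ s, f k) • m = ∑ k ∈ s, f k • m := map_sum (LeftModule.orbitHom m) f s

variable (M) in
/-- The elements of a module that are fixed by a given element of the ring. -/
def fixedSubgroup (e : A) : AddSubgroup M where
  carrier := {m | e • m = m}
  zero_mem' := LeftModule.smul_zero e
  add_mem' {m n} hm hn := by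
    change e • (m + n) = m + n
    rw [LeftModule.smul_add, hm, hn]
  neg_mem' {m} hm := by
    change e • -m = -m
    rw [LeftModule.smul_neg, hm]

variable {T : Type*} [Ring T]

/-- A homomorphism from a unital ring turns the elements fixed by the image of `1` into a module. -/
@[reducible]
def fixedModule (ι : T →ₙ+* A) : Module T (fixedSubgroup M (ι 1)) where
  smul t m := ⟨ι t • m.1, by
    change ι 1 • ι t • m.1 = _
    rw [← LeftModule.mul_smul, ← map_mul, one_mul]⟩
  one_smul m := Subtype.ext m.2
  mul_smul s t m := Subtype.ext <| by
    change ι (s * t) • m.1 = ι s • ι t • m.1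
    rw [map_mul, LeftModule.mul_smul]
  smul_zero t := Subtype.ext (LeftModule.smul_zero _)
  smul_add t m n := Subtype.ext (LeftModule.smul_add _ _ _)
  add_smul s t m := Subtype.ext <| by
    change ι (s + t) • m.1 = ι s • m.1 + ι t • m.1
    rw [map_add, LeftModule.add_smul]
  zero_smul m := Subtype.ext <| by
    change ι 0 • m.1 = 0
    rw [map_zero, LeftModule.zero_smul]

section

variable (ι : T →ₙ+* A) {κ : Type*} (b c : κ → A)

/-- The fixed elements inside a submodule. -/
def fixedPart (N : LeftSubmodule A M) :
    letI := fixedModule (M := M) ι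
    Submodule T (fixedSubgroup M (ι 1)) :=
  letI := fixedModule (M := M) ι
  { carrier := {m | m.1 ∈ N.1}
    zero_mem' := N.1.zero_mem
    add_mem' := fun hm hn => N.1.add_mem hm hn
    smul_mem' := fun t m hm => N.2 (ι t) m.1 hm }

variable {ι b c}

/-- With `e = ι 1`, the hypothesis on `M` expresses each `m` through the elements `e c m` of `e M`.
A submodule `N` is thus generated by its fixed part `e N`, and distinct submodules have distinct
fixed parts. -/
theorem strictMono_fixedPart
    (hM : ∀ m : M, ∃ u : Finset κ, m = ∑ p ∈ u, b p • (ι 1 * c p) • m) :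
    letI := fixedModule (M := M) ι
    StrictMono (fixedPart (M := M) ι) := by
  refine Monotone.strictMono_of_injective (fun N N' h m hm => h hm) ?_
  have key : ∀ N N' : LeftSubmodule A M, fixedPart ι N = fixedPart ι N' → N.1 ≤ N'.1 := by
    intro N N' h m hm
    obtain ⟨u, hu⟩ := hM m
    rw [hu]
    refine sum_mem fun p _ => N'.2 _ _ ?_
    have h1 : (ι 1 * c p) • m ∈ fixedSubgroup M (ι 1) := by
      change ι 1 • (ι 1 * c p) • m = _
      rw [← LeftModule.mul_smul, ← mul_assoc, ← map_mul, one_mul]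
    have h2 : (⟨_, h1⟩ : fixedSubgroup M (ι 1)) ∈ fixedPart ι N := N.2 _ _ hm
    rw [h] at h2
    exact h2
  exact fun N N' h => Subtype.ext (le_antisymm (key N N' h) (key N' N h.symm))

/-- If the `m` generate `M`, then the finitely many `e c m` occurring in their expansions generate
`e M`: a coefficient `e a b e` comes from `T`, since by `hι` the image of `ι` contains `e A e`. -/
theorem finite_fixedSubgroup (hι : ∀ a, ∃ t, ι t = ι 1 * a * ι 1)
    (hM : ∀ m : M, ∃ u : Finset κ, m = ∑ p ∈ u, b p • (ι 1 * c p) • m)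
    (hfg : IsFinitelyGenerated A M) :
    letI := fixedModule (M := M) ι
    Module.Finite T (fixedSubgroup M (ι 1)) := by
  classical
  let := fixedModule (M := M) ι
  obtain ⟨s, hs⟩ := hfg
  choose u hu using hM
  have h1 : ∀ (a : A) (m : M), (ι 1 * a) • m ∈ fixedSubgroup M (ι 1) := by
    intro a m
    change ι 1 • (ι 1 * a) • m = _
    rw [← LeftModule.mul_smul, ← mul_assoc, ← map_mul, one_mul]
  let gens : Finset (fixedSubgroup M (ι 1)) :=
    s.biUnion fun m => (u m).image fun p => ⟨_, h1 (c p) m⟩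
  -- Requiring `e a m` to lie in the span for every `a` makes this set stable under `A`. It contains
  -- the generators, hence is all of `M`, and `a = e` then gives the claim.
  let N : LeftSubmodule A M := ⟨
    { carrier := {m | ∀ a : A, (⟨_, h1 a m⟩ : fixedSubgroup M (ι 1)) ∈
        Submodule.span T (gens : Set (fixedSubgroup M (ι 1)))}
      zero_mem' := fun a => mem_of_eq_of_mem (Subtype.ext (LeftModule.smul_zero _))
        (Submodule.zero_mem _)
      add_mem' := fun {m n} hm hn a => mem_of_eq_of_mem (Subtype.ext (LeftModule.smul_add _ _ _))
        (Submodule.add_mem _ (hm a) (hn a))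
      neg_mem' := fun {m} hm a => mem_of_eq_of_mem (Subtype.ext (LeftModule.smul_neg _ _))
        (Submodule.neg_mem _ (hm a)) }, fun a m hm a' => by
        refine mem_of_eq_of_mem (Subtype.ext ?_) (hm (a' * a))
        change (ι 1 * a') • a • m = (ι 1 * (a' * a)) • m
        rw [← LeftModule.mul_smul, mul_assoc]⟩
  have hN : N.1 = ⊤ := by
    refine hs N fun m hm a => ?_
    have h2 : (⟨_, h1 a m⟩ : fixedSubgroup M (ι 1)) =
        ∑ p ∈ u m, (hι (a * b p)).choose • (⟨_, h1 (c p) m⟩ : fixedSubgroup M (ι 1)) := by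
      refine Subtype.ext ?_
      rw [AddSubgroup.val_finsetSum]
      change (ι 1 * a) • m = ∑ p ∈ u m, ι (hι (a * b p)).choose • (ι 1 * c p) • m
      conv_lhs => rw [hu m]
      rw [LeftModule.smul_sum]
      refine Finset.sum_congr rfl fun p _ => ?_
      rw [(hι (a * b p)).choose_spec]
      simp only [← LeftModule.mul_smul]
      congr 1
      have : ι 1 * ι 1 = ι 1 := by rw [← map_mul, one_mul]
      simp only [mul_assoc]
      rw [← mul_assoc (ι 1) (ι 1) (c p), this]
    rw [h2]
    refine sum_mem fun p hp => Submodule.smul_mem _ _ (Submodule.subset_span ?_)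
    exact Finset.mem_coe.2 (Finset.mem_biUnion.2 ⟨m, hm, Finset.mem_image_of_mem _ hp⟩)
  refine ⟨⟨gens, eq_top_iff.2 fun m _ => ?_⟩⟩
  have h3 : m.1 ∈ N.1 := hN ▸ AddSubgroup.mem_top _
  convert h3 (ι 1) using 1
  refine Subtype.ext ?_
  change m.1 = (ι 1 * ι 1) • m.1
  rw [← map_mul, one_mul]
  exact m.2.symm

theorem isNoetherianModule_of_fixedSubgroup [IsNoetherianRing T]
    (hι : ∀ a, ∃ t, ι t = ι 1 * a * ι 1)
    (hM : ∀ m : M, ∃ u : Finset κ, m = ∑ p ∈ u, b p • (ι 1 * c p) • m)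
    (hfg : IsFinitelyGenerated A M) : IsNoetherianModule A M := by
  let := fixedModule (M := M) ι
  have := finite_fixedSubgroup hι hM hfg
  exact (strictMono_fixedPart hM).wellFoundedGT

theorem isArtinianModule_of_fixedSubgroup [IsArtinianRing T]
    (hι : ∀ a, ∃ t, ι t = ι 1 * a * ι 1)
    (hM : ∀ m : M, ∃ u : Finset κ, m = ∑ p ∈ u, b p • (ι 1 * c p) • m)
    (hfg : IsFinitelyGenerated A M) : IsArtinianModule A M := by
  let := fixedModule (M := M) ι
  have := finite_fixedSubgroup hι hM hfg
  exact (strictMono_fixedPart hM).wellFoundedLT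

end

end LeftModules

/-! ## Corners -/

section Corners

variable {A : Type*} [NonUnitalRing A]

/-- The left ideal `A e`. -/
def leftMultiples (e : A) : AddSubgroup A where
  carrier := {a | a * e = a}
  zero_mem' := zero_mul e
  add_mem' {a b} ha hb := by
    change (a + b) * e = a + b
    rw [add_mul, ha, hb]
  neg_mem' {a} ha := by
    change -a * e = -a
    rw [neg_mul, ha]

instance (e : A) : LeftModule A (leftMultiples e) where
  smul a m := ⟨a * m.1, (mul_assoc _ _ _).trans (congrArg (a * ·) m.2)⟩
  smul_add _ _ _ := Subtype.ext (mul_add _ _ _)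
  add_smul _ _ _ := Subtype.ext (add_mul _ _ _)
  mul_smul _ _ _ := Subtype.ext (mul_assoc _ _ _)

variable {e : A} (he : IsIdempotentElem e)

include he in
theorem isUnitary_leftMultiples : IsUnitary A (leftMultiples e) := by
  refine eq_top_iff.2 fun m _ => AddSubgroup.subset_closure ?_
  exact ⟨m.1, ⟨e, he⟩, Subtype.ext m.2.symm⟩

include he in
theorem isFinitelyGenerated_leftMultiples : IsFinitelyGenerated A (leftMultiples e) := by
  refine ⟨{⟨e, he⟩}, fun N hN => eq_top_iff.2 fun m _ => ?_⟩
  have h := N.2 m.1 _ (hN (Finset.mem_coe.2 (Finset.mem_singleton_self _)))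
  convert h using 1
  exact Subtype.ext m.2.symm

/-- The largest submodule of `A e` whose intersection with `e A e` lies in a given left ideal. -/
def cornerExtension (I : Submodule he.Corner he.Corner) : LeftSubmodule A (leftMultiples e) :=
  have mem (a : A) (m : leftMultiples e) : e * a * m.1 ∈ Subsemigroup.corner e :=
    ⟨a * m.1, by simp only [mul_assoc]; rw [m.2]⟩
  ⟨{ carrier := {m | ∀ a : A, (⟨e * a * m.1, mem a m⟩ : he.Corner) ∈ I}
     zero_mem' := fun a => mem_of_eq_of_mem (Subtype.ext (mul_zero _)) I.zero_mem
     add_mem' := fun {m n} hm hn a => mem_of_eq_of_mem (Subtype.ext (mul_add _ _ _))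
      (I.add_mem (hm a) (hn a))
     neg_mem' := fun {m} hm a => mem_of_eq_of_mem (Subtype.ext (mul_neg _ _))
      (I.neg_mem (hm a)) }, fun a m hm a' => by
      refine mem_of_eq_of_mem (Subtype.ext ?_) (hm (a' * a))
      change e * a' * (a * m.1) = e * (a' * a) * m.1
      simp only [mul_assoc]⟩

/-- The ideal `I` is recovered as the part of its extension inside `e A e`: for `x` in `I` one has
`e a x = (e a e) x`, and conversely `a = e` returns `x`. -/
theorem strictMono_cornerExtension : StrictMono (cornerExtension he) := by
  refine Monotone.strictMono_of_injective (fun I I' h m hm a => h (hm a)) ?_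
  have key : ∀ I I' : Submodule he.Corner he.Corner,
      cornerExtension he I = cornerExtension he I' → I ≤ I' := by
    intro I I' h x hx
    have hx' := (Subsemigroup.mem_corner_iff he).1 x.2
    have h1 : (⟨x.1, hx'.2⟩ : leftMultiples e) ∈ (cornerExtension he I).1 := by
      intro a
      refine mem_of_eq_of_mem (Subtype.ext ?_) (I.smul_mem (⟨e * a * e, a, rfl⟩ : he.Corner) hx)
      change e * a * x.1 = e * a * e * x.1
      rw [mul_assoc (e * a), hx'.1]
    rw [h] at h1
    refine mem_of_eq_of_mem (Subtype.ext ?_) (h1 e)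
    change x.1 = e * e * x.1
    rw [he.eq, hx'.1]
  exact fun I I' h => le_antisymm (key I I' h) (key I' I h.symm)

theorem CategoricallyNoetherian.locallyNoetherian (h : CategoricallyNoetherian A) :
    LocallyNoetherian A := by
  intro e he
  have : WellFoundedGT _ :=
    h _ (isUnitary_leftMultiples he) (isFinitelyGenerated_leftMultiples he)
  have := (strictMono_cornerExtension he).wellFoundedGT
  exact isNoetherian_iff'.2 this

theorem CategoricallyArtinian.locallyArtinian (h : CategoricallyArtinian A) :
    LocallyArtinian A := by
  intro e he
  have : WellFoundedLT _ :=
    h _ (isUnitary_leftMultiples he) (isFinitelyGenerated_leftMultiples he)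
  exact (strictMono_cornerExtension he).wellFoundedLT

/-- Hopkins–Levitzki, applied to each unital corner. -/
theorem LocallyArtinian.locallyNoetherian (h : LocallyArtinian A) : LocallyNoetherian A := by
  intro e he
  have := h e he
  infer_instance

/-- The map of corners induced by a homomorphism. -/
def cornerMap {B : Type*} [NonUnitalRing B] (φ : A →ₙ+* B) {f : B} (hf : IsIdempotentElem f)
    (hef : φ e = f) : he.Corner →+* hf.Corner where
  toFun a := ⟨φ a.1, by
    obtain ⟨a, b, rfl⟩ := a
    exact ⟨φ b, by simp only [map_mul, hef]⟩⟩
  map_one' := Subtype.ext hef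
  map_mul' a b := Subtype.ext (map_mul φ _ _)
  map_zero' := Subtype.ext (map_zero φ)
  map_add' a b := Subtype.ext (map_add φ _ _)

theorem cornerMap_surjective {B : Type*} [NonUnitalRing B] {φ : A →ₙ+* B}
    (hφ : Function.Surjective φ) {f : B} (hf : IsIdempotentElem f) (hef : φ e = f) :
    Function.Surjective (cornerMap he φ hf hef) := by
  rintro ⟨_, b, rfl⟩
  obtain ⟨a, rfl⟩ := hφ b
  exact ⟨⟨_, a, rfl⟩, Subtype.ext (by
    change φ (e * a * e) = f * φ a * f
    simp only [map_mul, hef])⟩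

theorem isIdempotentElem_symm_apply {B : Type*} [NonUnitalRing B] (φ : A ≃+* B) {f : B}
    (hf : IsIdempotentElem f) : IsIdempotentElem (φ.symm f) := by
  change _ * _ = _
  rw [← map_mul, hf.eq]

theorem LocallyNoetherian.of_ringEquiv {B : Type*} [NonUnitalRing B] (φ : A ≃+* B)
    (h : LocallyNoetherian A) : LocallyNoetherian B := by
  intro f hf
  have := h _ (isIdempotentElem_symm_apply φ hf)
  exact isNoetherianRing_of_surjective _ _
    (cornerMap (isIdempotentElem_symm_apply φ hf) (φ : A →ₙ+* B) hf (φ.apply_symm_apply f))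
    (cornerMap_surjective _ φ.surjective _ _)

theorem LocallyArtinian.of_ringEquiv {B : Type*} [NonUnitalRing B] (φ : A ≃+* B)
    (h : LocallyArtinian A) : LocallyArtinian B := by
  intro f hf
  have := h _ (isIdempotentElem_symm_apply φ hf)
  exact Function.Surjective.isArtinianRing
    (f := cornerMap (isIdempotentElem_symm_apply φ hf) (φ : A →ₙ+* B) hf (φ.apply_symm_apply f))
    (cornerMap_surjective _ φ.surjective _ _)

end Corners

/-! ## Group rings -/

section GroupRings

/-- Let `φ` be a character of a left artinian algebra.  Then some right ideal `g A` with
`φ g ≠ 0` lies in a finitely generated module over the base ring. -/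
theorem exists_mul_mem_fg {R A K : Type*} [CommRing R] [Ring A] [Algebra R A] [IsArtinianRing A]
    [Field K] [Algebra R K] (hK : Function.Surjective (algebraMap R K)) (φ : A →ₐ[R] K) :
    ∃ g : A, φ g ≠ 0 ∧ ∃ N : Submodule R A, N.FG ∧ ∀ a, g * a ∈ N := by
  -- `L` is minimal among the left ideals not killed by `φ`, so `φ` vanishes on every left ideal
  -- properly inside `L`.
  obtain ⟨L, ⟨f, hfL, hf⟩, hL⟩ := WellFounded.has_min
    (wellFounded_lt : WellFounded ((· < ·) : Ideal A → Ideal A → Prop))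
    {L | ∃ f ∈ L, φ f ≠ 0} ⟨⊤, 1, trivial, by simp⟩
  have hL' : ∀ L' : Ideal A, L' < L → ∀ a ∈ L', φ a = 0 := by
    intro L' hlt a ha
    by_contra hc
    exact hL L' ⟨a, ha, hc⟩ hlt
  have dec : ∀ a : A, ∃ r : R, φ (a - algebraMap R A r) = 0 := by
    intro a
    obtain ⟨r, hr⟩ := hK (φ a)
    exact ⟨r, by simp [hr]⟩
  -- An artinian ring is noetherian, so there is a maximal left ideal `I` for which some `g` with `φ
  -- g ≠ 0` sends `I` into a finitely generated `R`-module. The claim is that `I` is the whole ring;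
  -- otherwise `I` is enlarged to an ideal `J` covering it.
  obtain ⟨I, ⟨g, hg, N, hN, hgN⟩, hI⟩ := WellFounded.has_min
    (wellFounded_gt : WellFounded ((· > ·) : Ideal A → Ideal A → Prop))
    {I | ∃ g : A, φ g ≠ 0 ∧ ∃ N : Submodule R A, N.FG ∧ ∀ a ∈ I, g * a ∈ N}
    ⟨⊥, 1, by simp, ⊥, Submodule.fg_bot, by simp⟩
  by_cases htop : I = ⊤
  · exact ⟨g, hg, N, hN, fun a => hgN a (htop ▸ trivial)⟩
  exfalso
  obtain ⟨J, hIJ⟩ := exists_covBy_of_wellFoundedLT (a := I) (by rwa [isMax_iff_eq_top])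
  -- If `L J ⊆ I`, replacing `g` by `g * f` handles `J`, and `φ (g * f) ≠ 0` because `K` is a field.
  by_cases hLJ : ∀ l ∈ L, ∀ m ∈ J, l * m ∈ I
  · refine hI J ⟨g * f, by simp [hg, hf], N, hN, fun a ha => ?_⟩ hIJ.lt
    rw [mul_assoc]
    exact hgN _ (hLJ f hfL a ha)
  push Not at hLJ
  obtain ⟨l₀, hl₀, m, hm, hlm⟩ := hLJ
  -- `J / I` is simple, so a left ideal `L'` with `L' m` not inside `I` already satisfies `J = I +
  -- L' m`.
  have hJ : ∀ L' : Ideal A, (∃ l ∈ L', l * m ∉ I) → ∀ a ∈ J, ∃ l ∈ L', a - l * m ∈ I := by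
    rintro L' ⟨l, hl, hlI⟩ a ha
    let P := I ⊔ Submodule.map (LinearMap.toSpanSingleton A A m) L'
    have hPJ : P = J := by
      refine (hIJ.eq_or_eq le_sup_left (sup_le hIJ.le ?_)).resolve_left ?_
      · rintro _ ⟨l', -, rfl⟩
        exact J.mul_mem_left _ hm
      · intro hP
        refine hlI (hP ▸ Submodule.mem_sup_right ⟨l, hl, rfl⟩)
    rw [← hPJ] at ha
    obtain ⟨i, hi, _, ⟨l', hl', rfl⟩, rfl⟩ := Submodule.mem_sup.1 ha
    exact ⟨l', hl', by simpa using hi⟩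
  have hker : ∀ l ∈ L, l * m ∈ I → φ l = 0 := by
    intro l hl hlI
    refine hL' (L ⊓ Submodule.comap (LinearMap.toSpanSingleton A A m) I) ?_ l ⟨hl, hlI⟩
    refine lt_of_le_of_ne inf_le_left fun h => hlm ?_
    rw [← h] at hl₀
    exact hl₀.2
  -- Together with `hker`, this shows that `l ↦ l m` induces an isomorphism from `L / (L ∩ ker φ)`
  -- onto `J / I`. If it failed, `L ∩ ker φ` would also map onto `J / I`, giving `f m ≡ l' m` with
  -- `φ l' = 0`, and `hker` would force `φ f = 0`.
  have hω : ∀ l ∈ L, φ l = 0 → l * m ∈ I := by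
    intro l hl hφ
    by_contra hc
    obtain ⟨l', ⟨hl'L, hl'⟩, hl'I⟩ := hJ (L ⊓ RingHom.ker φ) ⟨l, ⟨hl, hφ⟩, hc⟩ (f * m)
      (J.mul_mem_left _ hm)
    have := hker (f - l') (L.sub_mem hfL hl'L) (by rwa [sub_mul])
    rw [map_sub, RingHom.mem_ker.1 hl', sub_zero] at this
    exact hf this
  -- The ring now acts on `J / I` through `φ`, whose values all come from `R`. Hence `J = I + R (l₀
  -- m)`, and one extra generator `g * (l₀ * m)` suffices for `J`.
  refine hI J ⟨g, hg, N ⊔ Submodule.span R {g * (l₀ * m)},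
    hN.sup (Submodule.fg_span_singleton _), fun a ha => ?_⟩ hIJ.lt
  obtain ⟨t, ht', ht⟩ := hJ (Submodule.span A {l₀}) ⟨l₀, Submodule.mem_span_singleton_self _, hlm⟩ a ha
  obtain ⟨s, rfl⟩ := Submodule.mem_span_singleton.1 ht'
  obtain ⟨r, hr⟩ := dec s
  have h1 : ((s - algebraMap R A r) * l₀) * m ∈ I :=
    hω _ (L.mul_mem_left _ hl₀) (by rw [map_mul, hr, zero_mul])
  have h2 : a - r • (l₀ * m) ∈ I := by
    convert I.add_mem ht h1 using 1
    simp only [smul_eq_mul, sub_mul, mul_assoc, Algebra.smul_def]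
    abel
  have h3 : g * a = g * (a - r • (l₀ * m)) + r • (g * (l₀ * m)) := by
    rw [mul_sub, mul_smul_comm, sub_add_cancel]
  rw [h3]
  exact add_mem (Submodule.mem_sup_left (hgN _ h2)) (Submodule.mem_sup_right
    (Submodule.smul_mem _ _ (Submodule.mem_span_singleton_self _)))

/-- The augmentation maps the group ring onto `R`. -/
theorem isArtinianRing_of_monoidAlgebra {R G : Type*} [CommRing R] [Group G]
    [IsArtinianRing (MonoidAlgebra R G)] : IsArtinianRing R :=
  Function.Surjective.isArtinianRing
    (f := (MonoidAlgebra.lift R R G (1 : G →* R) : MonoidAlgebra R G →+* R))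
    fun r => ⟨algebraMap R _ r, (MonoidAlgebra.lift R R G (1 : G →* R)).commutes r⟩

/-- A group whose group ring over a nonzero commutative ring is artinian is finite. -/
theorem finite_of_isArtinianRing_monoidAlgebra (R : Type*) {G : Type*} [CommRing R] [Nontrivial R]
    [Group G] [IsArtinianRing (MonoidAlgebra R G)] : Finite G := by
  classical
  obtain ⟨𝔪, h𝔪⟩ := Ideal.exists_maximal R
  let := Ideal.Quotient.field 𝔪
  obtain ⟨g, hg, N, ⟨S, hS⟩, hN⟩ := exists_mul_mem_fg (R := R) (A := MonoidAlgebra R G)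
    Ideal.Quotient.mk_surjective (MonoidAlgebra.lift R (R ⧸ 𝔪) G 1)
  have hsupp : ∀ a ∈ N, a.coeff.support ⊆ S.biUnion fun s => s.coeff.support := by
    intro a ha
    rw [← hS] at ha
    induction ha using Submodule.span_induction with
    | mem s hs => exact Finset.subset_biUnion_of_mem (fun s => s.coeff.support) hs
    | zero => simp
    | add a b _ _ h1 h2 => exact Finsupp.support_add.trans (Finset.union_subset h1 h2)
    | smul r a _ h => exact Finsupp.support_smul.trans h
  obtain ⟨h, hh⟩ : ∃ h, g.coeff h ≠ 0 := by
    by_contra hc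
    push Not at hc
    have : g = 0 := by ext h; simp [hc]
    exact hg (by rw [this, map_zero])
  -- The coefficient of `g k` at `h * k` equals that of `g` at `h`, which is nonzero; so `k ↦ h * k`
  -- lands in the common finite support.
  refine Finite.of_injective (β := S.biUnion fun s => s.coeff.support) (fun k => ⟨h * k,
    hsupp _ (hN (MonoidAlgebra.single k 1)) ?_⟩) ?_
  · simpa using hh
  · intro k k' hk
    simpa using hk

/-- A group ring over a commutative ring is isomorphic to its opposite. -/
noncomputable def monoidAlgebraOpEquiv (R G : Type*) [CommRing R] [Group G] :
    (MonoidAlgebra R G)ᵐᵒᵖ ≃+* MonoidAlgebra R G :=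
  MonoidAlgebra.opRingEquiv.trans <|
    (MonoidAlgebra.mapDomainRingEquiv _ (MulEquiv.inv' G).symm).trans <|
    MonoidAlgebra.mapRingEquiv G (RingEquiv.toOpposite R).symm

end GroupRings
/-! ## Direct sums of rings of finitely supported matrices -/

section MatrixSums

namespace FinMatrix

variable {I S : Type*} [Ring S]

open Classical in
/-- The matrix with a single entry. -/
noncomputable def single (i k : I) (s : S) : FinMatrix I S :=
  ⟨fun a b => if a = i ∧ b = k then s else 0, by
    refine (Set.finite_singleton (i, k)).subset fun p hp => ?_
    by_contra hc
    exact hp (if_neg fun h => hc (Prod.ext h.1 h.2))⟩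

open Classical in
theorem single_apply (i k : I) (s : S) (a b : I) :
    (single i k s).1 a b = if a = i ∧ b = k then s else 0 := rfl

theorem ext {M N : FinMatrix I S} (h : ∀ i k, M.1 i k = N.1 i k) : M = N :=
  Subtype.ext (funext fun i => funext fun k => h i k)

theorem mul_apply (M N : FinMatrix I S) (i k : I) :
    (M * N).1 i k = ∑ᶠ j, M.1 i j * N.1 j k := rfl

theorem add_apply (M N : FinMatrix I S) (i k : I) : (M + N).1 i k = M.1 i k + N.1 i k := rfl

theorem zero_apply (i k : I) : (0 : FinMatrix I S).1 i k = 0 := rfl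

open Classical in
theorem single_mul_apply (i k : I) (s : S) (M : FinMatrix I S) (a b : I) :
    (single i k s * M).1 a b = if a = i then s * M.1 k b else 0 := by
  rw [mul_apply, finsum_eq_single _ k fun j hj => by simp [single_apply, hj]]
  simp [single_apply]

open Classical in
theorem mul_single_apply (i k : I) (s : S) (M : FinMatrix I S) (a b : I) :
    (M * single i k s).1 a b = if b = k then M.1 a i * s else 0 := by
  rw [mul_apply, finsum_eq_single _ i fun j hj => by simp [single_apply, hj]]
  simp [single_apply]

theorem single_add (i k : I) (s t : S) : single i k (s + t) = single i k s + single i k t := by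
  refine ext fun a b => ?_
  simp only [add_apply, single_apply]
  split_ifs <;> simp

theorem single_zero (i k : I) : single i k (0 : S) = 0 := by
  refine ext fun a b => ?_
  simp [zero_apply, single_apply]

theorem single_mul_single (i k l : I) (s t : S) :
    single i k s * single k l t = single i l (s * t) := by
  refine ext fun a b => ?_
  rw [single_mul_apply]
  simp only [single_apply]
  by_cases ha : a = i <;> by_cases hb : b = l <;> simp [ha, hb]

theorem single_mul_mul_single (i k : I) (M : FinMatrix I S) :
    single i i 1 * M * single k k 1 = single i k (M.1 i k) := by
  refine ext fun a b => ?_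
  rw [mul_single_apply, single_mul_apply, single_apply]
  by_cases ha : a = i <;> by_cases hb : b = k <;> simp [ha, hb]

end FinMatrix

variable {J : Type*} {I : J → Type*} {S : J → Type*} [∀ j, Ring (S j)]

open Classical in
/-- An element of a direct sum of rings with a single nonzero component. -/
noncomputable def componentHom {B : J → Type*} [∀ j, NonUnitalRing (B j)] (j : J) :
    B j →ₙ+* ringDirectSum B where
  toFun b := ⟨Pi.single j b, (Set.finite_singleton j).subset fun k hk => by
    by_contra hc
    exact hk (Pi.single_eq_of_ne hc b)⟩
  map_mul' a b := Subtype.ext (Pi.single_mul j a b)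
  map_zero' := Subtype.ext (Pi.single_zero j)
  map_add' a b := Subtype.ext (Pi.single_add j a b)

variable (I S) in
/-- The direct sum of the matrix rings `M_{I j}(S j)`. -/
abbrev MatrixSum := ↥(ringDirectSum fun j => FinMatrix (I j) (S j))

namespace MatrixSum

theorem ext {a b : MatrixSum I S} (h : ∀ j i k, (a.1 j).1 i k = (b.1 j).1 i k) : a = b :=
  Subtype.ext (funext fun j => FinMatrix.ext (h j))

/-- The diagonal matrix unit at an index. -/
noncomputable def unitAt (p : Σ j, I j) : MatrixSum I S :=
  componentHom p.1 (FinMatrix.single p.2 p.2 1)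

variable (S) in
/-- The diagonal idempotent of a finite set of indices. -/
noncomputable def oneOn (D : Finset (Σ j, I j)) : MatrixSum I S := ∑ p ∈ D, unitAt p

/-- An entry, as an additive map. -/
noncomputable def entryHom (j : J) (i k : I j) : MatrixSum I S →+ S j :=
  AddMonoidHom.mk' (fun b => (b.1 j).1 i k) fun _ _ => rfl

open Classical in
theorem componentHom_apply_self (j : J) (b : FinMatrix (I j) (S j)) :
    (componentHom (B := fun j => FinMatrix (I j) (S j)) j b).1 j = b :=
  Pi.single_eq_same (M := fun j => FinMatrix (I j) (S j)) j b

open Classical in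
theorem componentHom_apply_of_ne {j j' : J} (h : j' ≠ j) (b : FinMatrix (I j) (S j)) :
    (componentHom (B := fun j => FinMatrix (I j) (S j)) j b).1 j' = 0 :=
  Pi.single_eq_of_ne (M := fun j => FinMatrix (I j) (S j)) h b

theorem mul_val (a b : MatrixSum I S) (j : J) : (a * b).1 j = a.1 j * b.1 j := rfl

open Classical in
theorem unitAt_mul_apply (p : Σ j, I j) (b : MatrixSum I S) (j : J) (i k : I j) :
    ((unitAt p * b).1 j).1 i k = if p = ⟨j, i⟩ then (b.1 j).1 i k else 0 := by
  obtain ⟨j', i'⟩ := p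
  rw [mul_val]
  by_cases h : j = j'
  · subst h
    rw [unitAt, componentHom_apply_self, FinMatrix.single_mul_apply]
    by_cases hi : i = i'
    · subst hi; simp
    · rw [if_neg hi, if_neg]
      rintro h
      cases h
      exact hi rfl
  · rw [unitAt, componentHom_apply_of_ne h, zero_mul, if_neg]
    · rfl
    · rintro h'
      cases h'
      exact h rfl

open Classical in
theorem oneOn_mul_apply (D : Finset (Σ j, I j)) (b : MatrixSum I S) (j : J) (i k : I j) :
    ((oneOn S D * b).1 j).1 i k = if (⟨j, i⟩ : Σ j, I j) ∈ D then (b.1 j).1 i k else 0 := by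
  change entryHom j i k (oneOn S D * b) = _
  rw [oneOn, Finset.sum_mul, map_sum]
  refine (Finset.sum_congr rfl fun p _ => unitAt_mul_apply p b j i k).trans ?_
  rw [Finset.sum_ite_eq' D]

theorem oneOn_mul_eq_self {D : Finset (Σ j, I j)} {b : MatrixSum I S}
    (h : ∀ j i k, (b.1 j).1 i k ≠ 0 → (⟨j, i⟩ : Σ j, I j) ∈ D) : oneOn S D * b = b := by
  refine ext fun j i k => ?_
  rw [oneOn_mul_apply]
  split_ifs with hD
  · rfl
  · by_contra hc
    exact hD (h j i k (Ne.symm hc))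

/-- These idempotents form a directed system of local units: any two are absorbed by the one
belonging to the union of their index sets. -/
theorem oneOn_mul_oneOn {D D' : Finset (Σ j, I j)} (h : D' ⊆ D) :
    oneOn S D * oneOn S D' = oneOn S D' := by
  classical
  have hidem : oneOn S D' * oneOn S D' = oneOn S D' := by
    rw [oneOn, Finset.sum_mul]
    refine Finset.sum_congr rfl fun p hp => ?_
    rw [Finset.mul_sum, Finset.sum_eq_single p]
    · rw [unitAt, ← map_mul, FinMatrix.single_mul_single, one_mul]
    · intro q _ hq
      refine ext fun j i k => ?_
      rw [unitAt_mul_apply]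
      split_ifs with hpj
      · subst hpj
        obtain ⟨j', i'⟩ := q
        change ((unitAt _).1 j).1 i k = 0
        by_cases hj : j = j'
        · subst hj
          rw [unitAt, componentHom_apply_self, FinMatrix.single_apply, if_neg]
          rintro ⟨h1, -⟩
          dsimp only at h1
          exact hq (by rw [h1])
        · rw [unitAt, componentHom_apply_of_ne hj]
          rfl
      · rfl
    · exact fun hc => absurd hp hc
  -- Idempotency, read entrywise through `oneOn_mul_apply`, shows that `oneOn S D'` has no nonzero
  -- row outside `D'`.
  refine oneOn_mul_eq_self fun j i k hne => h ?_
  by_contra hc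
  rw [← hidem, oneOn_mul_apply, if_neg hc] at hne
  exact hne rfl

theorem finite_rows (b : MatrixSum I S) :
    {p : Σ j, I j | ∃ k, (b.1 p.1).1 p.2 k ≠ 0}.Finite := by
  refine (Set.Finite.biUnion b.2 fun j _ =>
    (b.1 j).2.image fun p => (⟨j, p.1⟩ : Σ j, I j)).subset ?_
  rintro ⟨j, i⟩ ⟨k, hk⟩
  refine Set.mem_biUnion (x := j) (fun hc => hk ?_) ⟨(i, k), hk, rfl⟩
  rw [hc]
  rfl

/-- The rows that contain nonzero entries. -/
noncomputable def rows (b : MatrixSum I S) : Finset (Σ j, I j) := b.finite_rows.toFinset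

theorem mem_rows {b : MatrixSum I S} {p : Σ j, I j} :
    p ∈ rows b ↔ ∃ k, (b.1 p.1).1 p.2 k ≠ 0 := Set.Finite.mem_toFinset _

theorem oneOn_rows_mul (b : MatrixSum I S) : oneOn S (rows b) * b = b :=
  oneOn_mul_eq_self fun _ _ k h => mem_rows.2 ⟨k, h⟩

theorem oneOn_val_eq_zero {D : Finset (Σ j, I j)} {j : J} (h : ∀ p ∈ D, p.1 ≠ j) :
    (oneOn S D).1 j = 0 := by
  refine FinMatrix.ext fun i k => ?_
  rw [← oneOn_mul_oneOn subset_rfl, oneOn_mul_apply, if_neg fun hc => h _ hc rfl]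
  rfl

section Base

variable (o : ∀ j, I j)

open Classical in
variable (S) in
/-- The inclusion of a finite product of the coefficient rings, as matrices with one entry. -/
noncomputable def baseHom (F : Finset J) : (∀ j : F, S j) →ₙ+* MatrixSum I S where
  toFun t := ⟨fun j => if h : j ∈ F then FinMatrix.single (o j) (o j) (t ⟨j, h⟩) else 0,
    F.finite_toSet.subset fun j hj => by
      by_contra hc
      exact hj (dif_neg hc)⟩
  map_mul' s t := Subtype.ext <| funext fun j => by
    rw [mul_val]
    dsimp only
    split_ifs
    · rw [FinMatrix.single_mul_single]; rfl
    · rw [zero_mul]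
  map_zero' := Subtype.ext <| funext fun j => by
    dsimp only
    split_ifs
    · exact FinMatrix.single_zero _ _
    · rfl
  map_add' s t := Subtype.ext <| funext fun j => by
    change _ = (dite _ _ _ : FinMatrix (I j) (S j)) + (dite _ _ _ : FinMatrix (I j) (S j))
    dsimp only
    split_ifs
    · exact FinMatrix.single_add _ _ _ _
    · rw [add_zero]

theorem baseHom_val_of_mem {F : Finset J} {j : J} (h : j ∈ F) (t : ∀ j : F, S j) :
    (baseHom S o F t).1 j = FinMatrix.single (o j) (o j) (t ⟨j, h⟩) := dif_pos h

theorem baseHom_val_of_notMem {F : Finset J} {j : J} (h : j ∉ F) (t : ∀ j : F, S j) :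
    (baseHom S o F t).1 j = 0 := dif_neg h

/-- Cutting on both sides by the base idempotent leaves only the entries at `(o j, o j)` with `j ∈
F`, so its corner is exactly the finite product of coefficient rings. -/
theorem exists_baseHom_eq (F : Finset J) (b : MatrixSum I S) :
    ∃ t, baseHom S o F t = baseHom S o F 1 * b * baseHom S o F 1 := by
  refine ⟨fun j => (b.1 j).1 (o j) (o j), Subtype.ext (funext fun j => ?_)⟩
  rw [mul_val, mul_val]
  by_cases h : j ∈ F
  · rw [baseHom_val_of_mem o h, baseHom_val_of_mem o h]
    exact (FinMatrix.single_mul_mul_single _ _ _).symm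
  · rw [baseHom_val_of_notMem o h, baseHom_val_of_notMem o h, mul_zero]

/-- Every diagonal matrix unit in a summand from `F` factors through the base idempotent. This
supplies the elements `b` and `c` of the Morita argument. -/
theorem single_mul_baseHom_mul_single {F : Finset J} {p : Σ j, I j} (hp : p.1 ∈ F) :
    componentHom p.1 (FinMatrix.single p.2 (o p.1) 1) *
      (baseHom S o F 1 * componentHom p.1 (FinMatrix.single (o p.1) p.2 1)) =
      (unitAt p : MatrixSum I S) := by
  refine Subtype.ext (funext fun j => ?_)
  rw [mul_val, mul_val]
  by_cases h : j = p.1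
  · subst h
    rw [unitAt, componentHom_apply_self, componentHom_apply_self, componentHom_apply_self,
      baseHom_val_of_mem o hp, FinMatrix.single_mul_single, FinMatrix.single_mul_single]
    simp
  · rw [unitAt, componentHom_apply_of_ne h, componentHom_apply_of_ne h,
      componentHom_apply_of_ne h, zero_mul]

variable {M : Type*} [AddCommGroup M] [LeftModule (MatrixSum I S) M]

theorem exists_oneOn_smul (hM : IsUnitary (MatrixSum I S) M) (m : M) :
    ∃ D : Finset (Σ j, I j), oneOn S D • m = m := by
  classical
  have h : m ∈ AddSubgroup.closure {x : M | ∃ (a : MatrixSum I S) (m : M), x = a • m} :=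
    hM.symm.le (AddSubgroup.mem_top m)
  induction h using AddSubgroup.closure_induction with
  | mem x hx =>
    obtain ⟨a, m, rfl⟩ := hx
    exact ⟨rows a, by rw [← LeftModule.mul_smul, oneOn_rows_mul]⟩
  | zero => exact ⟨∅, LeftModule.smul_zero _⟩
  | add x y _ _ hx hy =>
    obtain ⟨D, hD⟩ := hx
    obtain ⟨D', hD'⟩ := hy
    refine ⟨D ∪ D', ?_⟩
    rw [LeftModule.smul_add]
    nth_rw 1 [← hD]
    nth_rw 1 [← hD']
    rw [← LeftModule.mul_smul, ← LeftModule.mul_smul, oneOn_mul_oneOn Finset.subset_union_left,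
      oneOn_mul_oneOn Finset.subset_union_right, hD, hD']
  | neg x _ hx =>
    obtain ⟨D, hD⟩ := hx
    exact ⟨D, by rw [LeftModule.smul_neg, hD]⟩

/-- In a finitely generated unitary module only finitely many matrix rings act nontrivially. -/
theorem exists_finset_oneOn_smul (hM : IsUnitary (MatrixSum I S) M)
    (hfg : IsFinitelyGenerated (MatrixSum I S) M) :
    ∃ F : Finset J, ∀ m : M, ∃ D : Finset (Σ j, I j), (∀ p ∈ D, p.1 ∈ F) ∧ oneOn S D • m = m := by
  classical
  obtain ⟨s, hs⟩ := hfg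
  choose D hD using exists_oneOn_smul hM
  let F : Finset J := s.biUnion fun m => (D m).image Sigma.fst
  let N : LeftSubmodule (MatrixSum I S) M := ⟨
    { carrier := {m | ∃ D : Finset (Σ j, I j), (∀ p ∈ D, p.1 ∈ F) ∧ oneOn S D • m = m}
      zero_mem' := ⟨∅, by simp, LeftModule.smul_zero _⟩
      add_mem' := by
        rintro x y ⟨D, hF, hD⟩ ⟨D', hF', hD'⟩
        refine ⟨D ∪ D', fun p hp => (Finset.mem_union.1 hp).elim (hF p) (hF' p), ?_⟩
        rw [LeftModule.smul_add]
        nth_rw 1 [← hD]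
        nth_rw 1 [← hD']
        rw [← LeftModule.mul_smul, ← LeftModule.mul_smul,
          oneOn_mul_oneOn Finset.subset_union_left,
          oneOn_mul_oneOn Finset.subset_union_right, hD, hD']
      neg_mem' := by
        rintro x ⟨D, hF, hD⟩
        exact ⟨D, hF, by rw [LeftModule.smul_neg, hD]⟩ }, by
    rintro b m ⟨D, hF, hD⟩
    -- Since `b m = (b * oneOn S D) m`, the rows of this product give a local unit for `b m`. They
    -- lie over `F` because the product vanishes in every component not met by `D`.
    refine ⟨rows (b * oneOn S D), fun p hp => ?_, ?_⟩
    · obtain ⟨k, hk⟩ := mem_rows.1 hp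
      by_contra hc
      refine hk ?_
      rw [mul_val, oneOn_val_eq_zero (j := p.1) fun q hq h => hc (by rw [← h]; exact hF q hq), mul_zero]
      rfl
    · conv_lhs => rw [← hD]
      rw [← LeftModule.mul_smul b, ← LeftModule.mul_smul, oneOn_rows_mul, LeftModule.mul_smul, hD]⟩
  have hN : N.1 = ⊤ := by
    refine hs N fun m hm => ⟨D m, fun p hp => ?_, hD m⟩
    exact Finset.mem_biUnion.2 ⟨m, hm, Finset.mem_image_of_mem _ hp⟩
  exact ⟨F, fun m => (hN ▸ AddSubgroup.mem_top m : m ∈ N.1)⟩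

theorem exists_eq_sum_smul (hM : IsUnitary (MatrixSum I S) M)
    (hfg : IsFinitelyGenerated (MatrixSum I S) M) :
    ∃ F : Finset J, ∀ m : M, ∃ D : Finset (Σ j, I j),
      m = ∑ p ∈ D, (componentHom p.1 (FinMatrix.single p.2 (o p.1) 1) : MatrixSum I S) •
        (baseHom S o F 1 * componentHom p.1 (FinMatrix.single (o p.1) p.2 1)) • m := by
  obtain ⟨F, hF⟩ := exists_finset_oneOn_smul hM hfg
  refine ⟨F, fun m => ?_⟩
  obtain ⟨D, hDF, hD⟩ := hF m
  refine ⟨D, ?_⟩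
  conv_lhs => rw [← hD]
  rw [oneOn, LeftModule.sum_smul]
  refine Finset.sum_congr rfl fun p hp => ?_
  rw [← LeftModule.mul_smul, single_mul_baseHom_mul_single o (hDF p hp)]

-- A finite product of noetherian rings is noetherian, so the Morita argument applies to the
-- summands indexed by `F`.
include o in
theorem isNoetherianModule [∀ j, IsNoetherianRing (S j)] (hM : IsUnitary (MatrixSum I S) M)
    (hfg : IsFinitelyGenerated (MatrixSum I S) M) : IsNoetherianModule (MatrixSum I S) M := by
  obtain ⟨F, hF⟩ := exists_eq_sum_smul o hM hfg
  exact isNoetherianModule_of_fixedSubgroup (exists_baseHom_eq o F) hF hfg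

include o in
theorem isArtinianModule [∀ j, IsArtinianRing (S j)] (hM : IsUnitary (MatrixSum I S) M)
    (hfg : IsFinitelyGenerated (MatrixSum I S) M) : IsArtinianModule (MatrixSum I S) M := by
  obtain ⟨F, hF⟩ := exists_eq_sum_smul o hM hfg
  exact isArtinianModule_of_fixedSubgroup (exists_baseHom_eq o F) hF hfg

end Base

theorem isIdempotentElem_unitAt (p : Σ j, I j) :
    IsIdempotentElem (unitAt p : MatrixSum I S) := by
  change _ * _ = _
  rw [unitAt, ← map_mul, FinMatrix.single_mul_single, one_mul]

/-- The corner at a diagonal matrix unit maps to the coefficient ring. -/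
noncomputable def cornerEntryHom (p : Σ j, I j) :
    (isIdempotentElem_unitAt (S := S) p).Corner →+* S p.1 where
  toFun a := (a.1.1 p.1).1 p.2 p.2
  map_one' := by
    change ((unitAt p : MatrixSum I S).1 p.1).1 p.2 p.2 = 1
    rw [unitAt, componentHom_apply_self, FinMatrix.single_apply, if_pos ⟨rfl, rfl⟩]
  map_zero' := rfl
  map_add' _ _ := rfl
  map_mul' a b := by
    change (a.1.1 p.1 * b.1.1 p.1).1 p.2 p.2 = _
    -- An element of the corner has its entries only in column `p.2`, so the sum defining the matrix
    -- product reduces to one term.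
    have ha : a.1.1 p.1 = a.1.1 p.1 * FinMatrix.single p.2 p.2 1 := by
      have hu : (unitAt p : MatrixSum I S).1 p.1 = FinMatrix.single p.2 p.2 1 :=
        componentHom_apply_self _ _
      have h := congrArg (fun b : MatrixSum I S => b.1 p.1)
        ((Subsemigroup.mem_corner_iff (isIdempotentElem_unitAt p)).1 a.2).2
      rw [← hu]
      exact h.symm
    rw [ha, mul_assoc, FinMatrix.mul_apply, finsum_eq_single _ p.2]
    · rw [FinMatrix.single_mul_apply, if_pos rfl, one_mul, ← ha]
    · intro j hj
      rw [FinMatrix.single_mul_apply, if_neg hj, mul_zero]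

theorem cornerEntryHom_surjective (p : Σ j, I j) :
    Function.Surjective (cornerEntryHom (S := S) p) := by
  intro s
  refine ⟨⟨componentHom p.1 (FinMatrix.single p.2 p.2 s),
    componentHom p.1 (FinMatrix.single p.2 p.2 s), ?_⟩, ?_⟩
  · change (componentHom p.1 (FinMatrix.single p.2 p.2 1) : MatrixSum I S) *
      componentHom p.1 (FinMatrix.single p.2 p.2 s) *
        componentHom p.1 (FinMatrix.single p.2 p.2 1) =
      componentHom p.1 (FinMatrix.single p.2 p.2 s)
    rw [← map_mul, ← map_mul, FinMatrix.single_mul_single, FinMatrix.single_mul_single,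
      one_mul, mul_one]
  · change ((componentHom p.1 (FinMatrix.single p.2 p.2 s) : MatrixSum I S).1 p.1).1 p.2 p.2 = s
    rw [componentHom_apply_self, FinMatrix.single_apply, if_pos ⟨rfl, rfl⟩]

theorem isNoetherianRing_coefficients (h : LocallyNoetherian (MatrixSum I S)) (p : Σ j, I j) :
    IsNoetherianRing (S p.1) :=
  have := h _ (isIdempotentElem_unitAt p)
  isNoetherianRing_of_surjective _ _ _ (cornerEntryHom_surjective p)

theorem isArtinianRing_coefficients (h : LocallyArtinian (MatrixSum I S)) (p : Σ j, I j) :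
    IsArtinianRing (S p.1) :=
  have := h _ (isIdempotentElem_unitAt p)
  (cornerEntryHom_surjective p).isArtinianRing

end MatrixSum

/-! ### Transport of chain conditions along a ring isomorphism. -/

section Transport

variable {A B : Type*} [NonUnitalRing A] [NonUnitalRing B] (φ : A ≃+* B)
  (M : Type*) [AddCommGroup M] [LeftModule A M]

/-- Restriction of the action along an isomorphism. -/
@[reducible]
def transportModule : LeftModule B M where
  smul b m := φ.symm b • m
  smul_add b m n := LeftModule.smul_add (φ.symm b) m n
  add_smul a b m := by
    change φ.symm (a + b) • m = φ.symm a • m + φ.symm b • m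
    rw [map_add, LeftModule.add_smul]
  mul_smul a b m := by
    change φ.symm (a * b) • m = φ.symm a • φ.symm b • m
    rw [map_mul, LeftModule.mul_smul]

variable {M}

theorem isUnitary_transport (h : IsUnitary A M) :
    letI := transportModule φ M
    IsUnitary B M := by
  let := transportModule φ M
  refine eq_top_iff.2 (h.symm.le.trans (AddSubgroup.closure_mono ?_))
  rintro _ ⟨a, m, rfl⟩
  refine ⟨φ a, m, ?_⟩
  change a • m = φ.symm (φ a) • m
  rw [φ.symm_apply_apply]

theorem isFinitelyGenerated_transport (h : IsFinitelyGenerated A M) :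
    letI := transportModule φ M
    IsFinitelyGenerated B M := by
  obtain ⟨s, hs⟩ := h
  refine ⟨s, fun N hN => hs ⟨N.1, fun a m hm => ?_⟩ hN⟩
  have := N.2 (φ a) m hm
  change φ.symm (φ a) • m ∈ _ at this
  rwa [φ.symm_apply_apply] at this

theorem exists_strictMono_transport :
    letI := transportModule φ M
    ∃ f : LeftSubmodule A M → LeftSubmodule B M, StrictMono f :=
  ⟨fun N => ⟨N.1, fun b m hm => N.2 (φ.symm b) m hm⟩, fun _ _ h => h⟩

/-- The modules are transported one at a time: the categorical condition on `A` concerns modules in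
the universe of `A`, which need not be that of the matrix sum. -/
theorem CategoricallyNoetherian.of_ringEquiv_matrixSum {J : Type*} {I : J → Type*}
    {S : J → Type*} [∀ j, Ring (S j)] (φ : A ≃+* MatrixSum I S) (o : ∀ j, I j)
    (hS : ∀ j, IsNoetherianRing (S j)) : CategoricallyNoetherian A := by
  intro M _ _ hM hfg
  let := transportModule φ M
  obtain ⟨f, hf⟩ := exists_strictMono_transport φ (M := M)
  have : WellFoundedGT _ :=
    MatrixSum.isNoetherianModule o (isUnitary_transport φ hM) (isFinitelyGenerated_transport φ hfg)
  exact hf.wellFoundedGT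

theorem CategoricallyArtinian.of_ringEquiv_matrixSum {J : Type*} {I : J → Type*}
    {S : J → Type*} [∀ j, Ring (S j)] (φ : A ≃+* MatrixSum I S) (o : ∀ j, I j)
    (hS : ∀ j, IsArtinianRing (S j)) : CategoricallyArtinian A := by
  intro M _ _ hM hfg
  let := transportModule φ M
  obtain ⟨f, hf⟩ := exists_strictMono_transport φ (M := M)
  have : WellFoundedLT _ :=
    MatrixSum.isArtinianModule o (isUnitary_transport φ hM) (isFinitelyGenerated_transport φ hfg)
  exact hf.wellFoundedLT

end Transport

end MatrixSums

/-! ## Groupoid algebras -/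

/-! ### Inversion of arrows and the opposite algebra. -/

section Opposite

variable {R : Type*} [CommRing R] {C : Type*} [Groupoid C]

theorem arrowInv_arrowInv (g : Arrow C) : arrowInv (arrowInv g) = g := by
  obtain ⟨x, y, g, rfl⟩ := g.mk_surjective
  simp [arrowInv]

/-- Right translation by `g` matches the two fibres over which the sums run; commutativity of `R`
allows the factors to be exchanged. -/
theorem convolution_comp_arrowInv (f k : Arrow C → R) :
    convolution (k ∘ arrowInv) (f ∘ arrowInv) = convolution f k ∘ arrowInv := by
  funext g
  obtain ⟨x, y, g, rfl⟩ := g.mk_surjective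
  change (∑ᶠ h : Σ z : C, (x ⟶ z), k (arrowInv (Arrow.mk (Groupoid.inv h.2 ≫ g))) *
      f (arrowInv (Arrow.mk h.2))) =
    ∑ᶠ h : Σ z : C, (y ⟶ z), f (Arrow.mk (Groupoid.inv h.2 ≫ Groupoid.inv g)) * k (Arrow.mk h.2)
  rw [← finsum_comp_equiv (fibreEquiv g)]
  refine finsum_congr fun h => ?_
  rw [mul_comm]
  congr 2 <;> simp [arrowInv, fibreEquiv]

variable [TopologicalSpace C] [TopologicalSpace (Arrow C)] [AmpleGroupoid C]

theorem IsCompactOpenBisection.preimage_arrowInv {U : Set (Arrow C)}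
    (hU : IsCompactOpenBisection U) : IsCompactOpenBisection (arrowInv ⁻¹' U) where
  isCompact := by
    rw [← Set.image_eq_preimage_of_inverse arrowInv_arrowInv arrowInv_arrowInv]
    exact hU.isCompact.image EtaleGroupoid.continuous_inv
  isOpen := hU.isOpen.preimage EtaleGroupoid.continuous_inv
  injOn_dom := fun g hg h hh hgh => by
    rw [← arrowInv_arrowInv g, ← arrowInv_arrowInv h, hU.injOn_ran hg hh hgh]
  injOn_ran := fun g hg h hh hgh => by
    rw [← arrowInv_arrowInv g, ← arrowInv_arrowInv h, hU.injOn_dom hg hh hgh]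

theorem comp_arrowInv_mem {f : Arrow C → R} (hf : f ∈ groupoidSubmodule R C) :
    f ∘ arrowInv ∈ groupoidSubmodule R C := by
  induction hf using Submodule.span_induction with
  | mem f hf =>
    obtain ⟨U, hU, rfl⟩ := hf
    exact Submodule.subset_span ⟨_, hU.preimage_arrowInv, rfl⟩
  | zero => exact zero_mem _
  | add f k _ _ hf hk => exact add_mem hf hk
  | smul r f _ hf => exact Submodule.smul_mem _ r hf

variable (R C) in
/-- Inversion of arrows identifies the groupoid algebra with its opposite. -/
noncomputable def GroupoidAlgebra.opEquiv : (GroupoidAlgebra R C)ᵐᵒᵖ ≃+* GroupoidAlgebra R C where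
  toFun f := ⟨f.unop.1 ∘ arrowInv, comp_arrowInv_mem f.unop.2⟩
  invFun f := .op ⟨f.1 ∘ arrowInv, comp_arrowInv_mem f.2⟩
  left_inv f := MulOpposite.unop_injective <| Subtype.ext <| funext fun g =>
    congrArg f.unop.1 (arrowInv_arrowInv g)
  right_inv f := Subtype.ext <| funext fun g => congrArg f.1 (arrowInv_arrowInv g)
  map_mul' f k := Subtype.ext (convolution_comp_arrowInv k.unop.1 f.unop.1).symm
  map_add' _ _ := rfl

end Opposite

/-! ### The chain condition on corners forces discreteness. -/

section Discreteness

variable {C : Type*} [Groupoid C]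

variable (C) in
/-- The unit at an object. -/
def unitArrow (x : C) : Arrow C := Arrow.mk (𝟙 x)

theorem unitArrow_injective : Function.Injective (unitArrow C) :=
  fun _ _ h => congrArg (fun g : Arrow C => g.left) h

theorem setMul_image_unitArrow (K L : Set C) :
    setMul (unitArrow C '' K) (unitArrow C '' L) = unitArrow C '' (K ∩ L) := by
  ext a
  constructor
  · rintro ⟨_, ⟨x, hx, rfl⟩, _, ⟨y, hy, rfl⟩, e, rfl⟩
    have e' : x = y := e
    subst e'
    exact ⟨x, ⟨hx, hy⟩, by simp [arrowMul, unitArrow]⟩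
  · rintro ⟨x, ⟨hx, hy⟩, rfl⟩
    exact ⟨_, ⟨x, hx, rfl⟩, _, ⟨x, hy, rfl⟩, rfl, by simp [arrowMul, unitArrow]⟩

variable [TopologicalSpace C] [TopologicalSpace (Arrow C)] [AmpleGroupoid C]

/-- The unit map is a continuous section of the domain map, and a continuous section of a local
homeomorphism is itself a local homeomorphism. -/
theorem isOpenEmbedding_unitArrow : Topology.IsOpenEmbedding (unitArrow C) := by
  have hd := EtaleGroupoid.isLocalHomeomorph_dom (C := C)
  refine IsLocalHomeomorph.isOpenEmbedding_of_injective ?_ unitArrow_injective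
  exact IsLocalHomeomorph.of_comp (g := fun g : Arrow C => g.left)
    (Homeomorph.refl C).isLocalHomeomorph hd
    (EtaleGroupoid.isInducing_unit (C := C)).continuous

theorem isCompactOpenBisection_image_unitArrow {K : Set C} (hK : IsCompact K) (hK' : IsOpen K) :
    IsCompactOpenBisection (unitArrow C '' K) where
  isCompact := hK.image isOpenEmbedding_unitArrow.continuous
  isOpen := isOpenEmbedding_unitArrow.isOpenMap _ hK'
  injOn_dom := by
    rintro _ ⟨x, -, rfl⟩ _ ⟨y, -, rfl⟩ h
    exact congrArg (unitArrow C) h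
  injOn_ran := by
    rintro _ ⟨x, -, rfl⟩ _ ⟨y, -, rfl⟩ h
    exact congrArg (unitArrow C) h

theorem exists_isCompact_isOpen_subset {V : Set C} (hV : IsOpen V) {x : C} (hx : x ∈ V) :
    ∃ K ⊆ V, IsCompact K ∧ IsOpen K ∧ x ∈ K := by
  obtain ⟨U, hU, hxU, hUV⟩ := (AmpleGroupoid.isTopologicalBasis (C := C)).exists_subset_of_mem_open
    (Set.mem_image_of_mem (unitArrow C) hx) (isOpenEmbedding_unitArrow.isOpenMap _ hV)
  refine ⟨unitArrow C ⁻¹' U, ?_, ?_, hU.isOpen.preimage isOpenEmbedding_unitArrow.continuous, hxU⟩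
  · intro y hy
    obtain ⟨z, hz, h⟩ := hUV hy
    rwa [← unitArrow_injective h]
  · rw [isOpenEmbedding_unitArrow.isInducing.isCompact_iff, Set.image_preimage_eq_of_subset]
    · exact hU.isCompact
    · exact hUV.trans (Set.image_subset_range _ _)

variable (R : Type*) [CommRing R]

/-- The characteristic function of a compact open set of units. -/
noncomputable def unitIndicator {K : Set C} (hK : IsCompact K) (hK' : IsOpen K) :
    GroupoidAlgebra R C :=
  ⟨(unitArrow C '' K).indicator 1,
    Submodule.subset_span ⟨_, isCompactOpenBisection_image_unitArrow hK hK', rfl⟩⟩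

theorem unitIndicator_mul {K L N : Set C} (hK : IsCompact K) (hK' : IsOpen K) (hL : IsCompact L)
    (hL' : IsOpen L) (hN : IsCompact N) (hN' : IsOpen N) (h : K ∩ L = N) :
    unitIndicator R hK hK' * unitIndicator R hL hL' = unitIndicator R hN hN' := by
  subst h
  refine Subtype.ext ?_
  refine (convolution_indicator (isCompactOpenBisection_image_unitArrow hL hL')).trans ?_
  rw [setMul_image_unitArrow]
  rfl

variable {R}

/-- Passing to annihilators turns a descending family of neighbourhoods into an ascending family of
left ideals, to which the noetherian condition applies. -/
theorem isOpen_singleton_of_locallyNoetherian [Nontrivial R]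
    (h : LocallyNoetherian (GroupoidAlgebra R C)) (x : C) : IsOpen ({x} : Set C) := by
  have : T2Space C := AmpleGroupoid.t2Space_unit
  obtain ⟨K, -, hK, hK', hxK⟩ := exists_isCompact_isOpen_subset isOpen_univ (Set.mem_univ x)
  have he : IsIdempotentElem (unitIndicator R hK hK') :=
    unitIndicator_mul R hK hK' hK hK' hK hK' (Set.inter_self K)
  have := h _ he
  let T := {L : Set C // IsCompact L ∧ IsOpen L ∧ x ∈ L ∧ L ⊆ K}
  let δ : T → GroupoidAlgebra R C := fun L => unitIndicator R L.2.1 L.2.2.1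
  let F : T → Ideal he.Corner := fun L =>
    { carrier := {a | a.1 * δ L = 0}
      zero_mem' := zero_mul (δ L)
      add_mem' := fun {a b} ha hb => by
        change (a.1 + b.1) * δ L = 0
        rw [add_mul, ha, hb, add_zero]
      smul_mem' := fun a b hb => by
        change a.1 * b.1 * δ L = 0
        rw [mul_assoc, hb, mul_zero] }
  obtain ⟨L, -, hL⟩ := WellFounded.has_min
    (InvImage.wf F (wellFounded_gt : WellFounded ((· > ·) : Ideal he.Corner → _ → Prop)))
    Set.univ ⟨⟨K, hK, hK', hxK, subset_rfl⟩, trivial⟩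
  suffices hLx : L.1 = {x} by
    rw [← hLx]
    exact L.2.2.1
  refine Set.Subset.antisymm (fun y hy => ?_) (Set.singleton_subset_iff.2 L.2.2.2.1)
  by_contra hyx
  obtain ⟨N, hNL, hN, hN', hxN⟩ := exists_isCompact_isOpen_subset
    (L.2.2.1.inter (isOpen_compl_singleton (x := y))) ⟨L.2.2.2.1, fun hc => hyx hc.symm⟩
  have hNL' : N ⊆ L.1 := hNL.trans Set.inter_subset_left
  let N' : T := ⟨N, hN, hN', hxN, hNL'.trans L.2.2.2.2⟩
  have hLN : δ L * δ N' = δ N' :=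
    unitIndicator_mul R _ _ _ _ _ _ (Set.inter_eq_self_of_subset_right hNL')
  have hNL : δ N' * δ L = δ N' :=
    unitIndicator_mul R _ _ _ _ _ _ (Set.inter_eq_self_of_subset_left hNL')
  have hFL : F L ≤ F N' := fun a ha => by
    change a.1 * δ N' = 0
    rw [← hLN, ← mul_assoc, show a.1 * δ L = 0 from ha, zero_mul]
  have hFN : F N' ≤ F L := by
    by_contra hc
    exact hL N' trivial (lt_of_le_not_ge hFL hc)
  have hKN : unitIndicator R hK hK' * δ N' = δ N' :=
    unitIndicator_mul R _ _ _ _ _ _ (Set.inter_eq_self_of_subset_right N'.2.2.2.2)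
  have hNK : δ N' * unitIndicator R hK hK' = δ N' :=
    unitIndicator_mul R _ _ _ _ _ _ (Set.inter_eq_self_of_subset_left N'.2.2.2.2)
  have hKL : unitIndicator R hK hK' * δ L = δ L :=
    unitIndicator_mul R _ _ _ _ _ _ (Set.inter_eq_self_of_subset_right L.2.2.2.2)
  have hNN : δ N' * δ N' = δ N' := unitIndicator_mul R _ _ _ _ _ _ (Set.inter_self _)
  -- This difference annihilates the indicator of `N`, hence also that of `L`. So the two indicators
  -- agree, although they take the values `0` and `1` at `y`.
  let d : he.Corner := ⟨unitIndicator R hK hK' - δ N',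
    (Subsemigroup.mem_corner_iff he).2 ⟨by rw [mul_sub, he.eq, hKN], by rw [sub_mul, he.eq, hNK]⟩⟩
  have hd : (unitIndicator R hK hK' - δ N') * δ L = 0 :=
    hFN (show d ∈ F N' from (sub_mul _ _ _).trans (by rw [hKN, hNN, sub_self]))
  rw [sub_mul, hKL, hNL, sub_eq_zero] at hd
  have h1 := congrFun (congrArg Subtype.val hd) (unitArrow C y)
  have h2 : (δ L).1 (unitArrow C y) = 1 := Set.indicator_of_mem (Set.mem_image_of_mem _ hy) _
  have h3 : (δ N').1 (unitArrow C y) = 0 := by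
    refine Set.indicator_of_notMem ?_ _
    rw [unitArrow_injective.mem_set_image]
    intro hc
    exact (‹N ⊆ L.1 ∩ {y}ᶜ› hc).2 rfl
  rw [h2, h3] at h1
  exact one_ne_zero h1

theorem LocallyNoetherian.discreteTopology [Nontrivial R]
    (h : LocallyNoetherian (GroupoidAlgebra R C)) : DiscreteTopology (Arrow C) := by
  have : DiscreteTopology C :=
    discreteTopology_iff_isOpen_singleton.2 (isOpen_singleton_of_locallyNoetherian h)
  exact (EtaleGroupoid.isLocalHomeomorph_dom (C := C)).comap_discreteTopology

end Discreteness

/-! ### Matrix coordinates for discrete groupoids. -/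

section Discrete

variable {R : Type*} [CommRing R] {C : Type*} [Groupoid C]

theorem finite_support_of_mem [TopologicalSpace (Arrow C)] [DiscreteTopology (Arrow C)] {f : Arrow C → R}
    (hf : f ∈ groupoidSubmodule R C) : f.support.Finite := by
  induction hf using Submodule.span_induction with
  | mem f hf =>
    obtain ⟨U, hU, rfl⟩ := hf
    exact hU.isCompact.finite_of_discrete.subset Set.support_indicator_subset
  | zero => simp
  | add f k _ _ hf hk => exact (hf.union hk).subset (Function.support_add _ _)
  | smul r f _ hf => exact hf.subset (Function.support_const_smul_subset r f)

theorem mem_of_finite_support [TopologicalSpace (Arrow C)] [DiscreteTopology (Arrow C)] {f : Arrow C → R}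
    (hf : f.support.Finite) : f ∈ groupoidSubmodule R C := by
  classical
  have h : f = ∑ g ∈ hf.toFinset, f g • Set.indicator {g} (1 : Arrow C → R) := by
    funext g
    rw [Finset.sum_apply]
    simp [Pi.single_apply]
  rw [h]
  refine sum_mem fun g _ => Submodule.smul_mem _ _ (Submodule.subset_span ⟨{g}, ?_, rfl⟩)
  exact ⟨isCompact_singleton, isOpen_discrete _, Set.injOn_singleton _ _, Set.injOn_singleton _ _⟩

variable {J : Type*} {x : J → C}

/-- A chosen arrow from the base point of an orbit. -/
noncomputable def baseArrow (j : J) (y : orbit (x j)) : x j ⟶ y.1 := y.2.some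

/-- Arrows in coordinates: an orbit, the range and the domain, and an isotropy arrow. -/
noncomputable def coordArrow (j : J) (i k : orbit (x j)) (h : End (x j)) : Arrow C :=
  Arrow.mk (Groupoid.inv (baseArrow j k) ≫ h ≫ baseArrow j i)

theorem coordArrow_bijective (hx : ∀ y : C, ∃! j : J, y ∈ orbit (x j)) :
    Function.Bijective fun p : Σ j, orbit (x j) × orbit (x j) × End (x j) =>
      coordArrow p.1 p.2.1 p.2.2.1 p.2.2.2 := by
  constructor
  · rintro ⟨j, i, k, h⟩ ⟨j', i', k', h'⟩ heq
    have hk : k.1 = k'.1 := congrArg (fun g : Arrow C => g.left) heq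
    have hi : i.1 = i'.1 := congrArg (fun g : Arrow C => g.right) heq
    obtain rfl : j = j' := (hx k.1).unique k.2 (hk ▸ k'.2)
    obtain rfl := Subtype.ext hk
    obtain rfl := Subtype.ext hi
    have : Groupoid.inv (baseArrow j k) ≫ h ≫ baseArrow j i =
        Groupoid.inv (baseArrow j k) ≫ h' ≫ baseArrow j i := Arrow.mk_injective _ _ heq
    rw [cancel_epi, cancel_mono] at this
    rw [this]
  · intro g
    obtain ⟨y, z, g, rfl⟩ := g.mk_surjective
    obtain ⟨j, hj, -⟩ := hx y
    have hz : z ∈ orbit (x j) := ⟨hj.some ≫ g⟩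
    refine ⟨⟨j, ⟨z, hz⟩, ⟨y, hj⟩, baseArrow j ⟨y, hj⟩ ≫ g ≫ Groupoid.inv (baseArrow j ⟨z, hz⟩)⟩, ?_⟩
    simp [coordArrow]

/-- The bijection between coordinates and arrows. -/
noncomputable def coordEquiv (hx : ∀ y : C, ∃! j : J, y ∈ orbit (x j)) :
    (Σ j, orbit (x j) × orbit (x j) × End (x j)) ≃ Arrow C :=
  Equiv.ofBijective _ (coordArrow_bijective hx)

theorem coordArrow_injective (hx : ∀ y : C, ∃! j : J, y ∈ orbit (x j)) (j : J) :
    Function.Injective fun p : orbit (x j) × orbit (x j) × End (x j) =>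
      coordArrow j p.1 p.2.1 p.2.2 :=
  (coordArrow_bijective hx).1.comp sigma_mk_injective

/-- The arrows with a fixed domain, in coordinates. -/
noncomputable def fibreCoordEquiv (j : J) (l : orbit (x j)) :
    orbit (x j) × End (x j) ≃ Σ z : C, (l.1 ⟶ z) where
  toFun p := ⟨p.1.1, Groupoid.inv (baseArrow j l) ≫ p.2 ≫ baseArrow j p.1⟩
  invFun m :=
    have hm : m.1 ∈ orbit (x j) := ⟨baseArrow j l ≫ m.2⟩
    ⟨⟨m.1, hm⟩, baseArrow j l ≫ m.2 ≫ Groupoid.inv (baseArrow j ⟨m.1, hm⟩)⟩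
  left_inv p := by
    refine Prod.ext rfl ?_
    change baseArrow j l ≫ (Groupoid.inv (baseArrow j l) ≫ p.2 ≫ baseArrow j p.1) ≫
      Groupoid.inv (baseArrow j p.1) = p.2
    simp
  right_inv m := by simp

/-- The arrows with domain `l` are parametrised by a middle index and an isotropy element. The sum
over the former is the matrix product, the sum over the latter the product in the group ring. -/
theorem convolution_coordArrow (f k : Arrow C → R) (j : J) (i l : orbit (x j)) (h : End (x j)) :
    convolution f k (coordArrow j i l h) = ∑ᶠ p : orbit (x j) × End (x j),
      f (coordArrow j i p.1 (h * p.2⁻¹)) * k (coordArrow j p.1 l p.2) := by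
  change (∑ᶠ m : Σ z : C, (l.1 ⟶ z), f (Arrow.mk (Groupoid.inv m.2 ≫
    Groupoid.inv (baseArrow j l) ≫ h ≫ baseArrow j i)) * k (Arrow.mk m.2)) = _
  rw [← finsum_comp_equiv (fibreCoordEquiv j l)]
  refine finsum_congr fun p => ?_
  -- In `End` the product `a * b` is `b ≫ a`, the same order as for products of arrows; hence rows
  -- are indexed by ranges and columns by domains.
  have h1 : h * p.2⁻¹ = Groupoid.inv p.2 ≫ h := rfl
  rw [h1]
  congr 2
  simp [coordArrow, fibreCoordEquiv]

section Coordinates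

variable (hx : ∀ y : C, ∃! j : J, y ∈ orbit (x j))

/-- An entry of the matrix of a finitely supported function on arrows. -/
noncomputable def coordEntry {f : Arrow C → R} (hf : f.support.Finite) (j : J)
    (i k : orbit (x j)) : IsotropyRing R (x j) :=
  .ofCoeff <| Finsupp.ofSupportFinite (fun h => f (coordArrow j i k h)) <|
    hf.preimage (f := fun h => coordArrow j i k h) fun h _ h' _ heq => by
      have : Groupoid.inv (baseArrow j k) ≫ h ≫ baseArrow j i =
        Groupoid.inv (baseArrow j k) ≫ h' ≫ baseArrow j i := Arrow.mk_injective _ _ heq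
      rwa [cancel_epi, cancel_mono] at this

theorem coordEntry_coeff {f : Arrow C → R} (hf : f.support.Finite) (j : J)
    (i k : orbit (x j)) (h : End (x j)) :
    (coordEntry hf j i k).coeff h = f (coordArrow j i k h) := rfl

theorem exists_of_coordEntry_ne_zero {f : Arrow C → R} {hf : f.support.Finite} {j : J}
    {i k : orbit (x j)} (hne : coordEntry hf j i k ≠ 0) : ∃ h, f (coordArrow j i k h) ≠ 0 := by
  by_contra hc
  push Not at hc
  refine hne ?_
  ext h
  exact hc h

/-- The matrices of a finitely supported function on arrows. -/
noncomputable def coordMatrix {f : Arrow C → R} (hf : f.support.Finite) : OrbitMatrixSum R x :=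
  have hP := hf.preimage (coordEquiv hx).injective.injOn
  have hM (j : J) : {p : orbit (x j) × orbit (x j) | coordEntry hf j p.1 p.2 ≠ 0}.Finite := by
    refine ((hP.preimage sigma_mk_injective.injOn).image
      fun q : orbit (x j) × orbit (x j) × End (x j) => (q.1, q.2.1)).subset ?_
    rintro ⟨i, k⟩ hik
    obtain ⟨h, hh⟩ := exists_of_coordEntry_ne_zero hik
    exact ⟨(i, k, h), hh, rfl⟩
  ⟨fun j => ⟨fun i k => coordEntry hf j i k, hM j⟩, by
    refine (hP.image Sigma.fst).subset fun j hj => ?_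
    by_contra hc
    refine hj (FinMatrix.ext fun i k => ?_)
    by_contra hik
    obtain ⟨h, hh⟩ := exists_of_coordEntry_ne_zero (hf := hf) hik
    exact hc ⟨⟨j, i, k, h⟩, hh, rfl⟩⟩

theorem coordMatrix_convolution {f k : Arrow C → R} (hf : f.support.Finite) (hk : k.support.Finite)
    (hfk : (convolution f k).support.Finite) :
    coordMatrix hx hfk = coordMatrix hx hf * coordMatrix hx hk := by
  refine MatrixSum.ext fun j i l => ?_
  rw [MatrixSum.mul_val, FinMatrix.mul_apply]
  change coordEntry hfk j i l = ∑ᶠ m, coordEntry hf j i m * coordEntry hk j m l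
  ext h
  let ev : IsotropyRing R (x j) →+ R :=
    AddMonoidHom.mk' (fun a => a.coeff h) fun _ _ => rfl
  have hinj : Function.Injective fun p : orbit (x j) × End (x j) => coordArrow j p.1 l p.2 := by
    intro p q hpq
    have := coordArrow_injective hx j (a₁ := (p.1, l, p.2)) (a₂ := (q.1, l, q.2)) hpq
    simp only [Prod.mk.injEq, true_and] at this
    exact Prod.ext this.1 this.2
  have hfin : (Function.support fun p : orbit (x j) × End (x j) =>
      f (coordArrow j i p.1 (h * p.2⁻¹)) * k (coordArrow j p.1 l p.2)).Finite :=
    (hk.preimage hinj.injOn).subset fun p hp hc => hp (by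
      change k (coordArrow j p.1 l p.2) = 0 at hc
      simp only [hc, mul_zero])
  have hsupp : (Function.support fun m => coordEntry hf j i m * coordEntry hk j m l).Finite := by
    refine ((hk.preimage hinj.injOn).image Prod.fst).subset fun m hm => ?_
    obtain ⟨a, ha⟩ := exists_of_coordEntry_ne_zero (right_ne_zero_of_mul hm)
    exact ⟨(m, a), ha, rfl⟩
  -- Splitting the finite double sum leaves, for each middle index `m`, the coefficient at `h` of a
  -- product of two group ring elements.
  rw [coordEntry_coeff, convolution_coordArrow, finsum_curry _ hfin]
  change _ = ev (∑ᶠ m, _)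
  rw [AddMonoidHom.map_finsum ev hsupp]
  refine finsum_congr fun m => ?_
  change _ = (coordEntry hf j i m * coordEntry hk j m l).coeff h
  rw [MonoidAlgebra.coeff_mul_apply_right, Finsupp.sum]
  refine finsum_eq_sum_of_support_subset _ fun a ha => ?_
  rw [Finset.mem_coe, Finsupp.mem_support_iff]
  exact right_ne_zero_of_mul ha

/-- The finitely supported function on arrows with given matrices. -/
noncomputable def ofCoordMatrix (b : OrbitMatrixSum R x) (g : Arrow C) : R :=
  let p := (coordEquiv hx).symm g
  ((b.1 p.1).1 p.2.1 p.2.2.1).coeff p.2.2.2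

theorem ofCoordMatrix_coordArrow (b : OrbitMatrixSum R x) (j : J) (i k : orbit (x j))
    (h : End (x j)) :
    ofCoordMatrix hx b (coordArrow j i k h) = ((b.1 j).1 i k).coeff h := by
  have : (coordEquiv hx).symm (coordArrow j i k h) = ⟨j, i, k, h⟩ :=
    (coordEquiv hx).symm_apply_eq.2 rfl
  simp only [ofCoordMatrix]
  rw [this]

theorem finite_support_ofCoordMatrix (b : OrbitMatrixSum R x) :
    (ofCoordMatrix hx b).support.Finite := by
  have h : (⋃ j ∈ {j | b.1 j ≠ 0}, ⋃ p ∈ {p : orbit (x j) × orbit (x j) | (b.1 j).1 p.1 p.2 ≠ 0},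
      (fun h => coordArrow j p.1 p.2 h) '' (((b.1 j).1 p.1 p.2).coeff.support : Set _)).Finite :=
    Set.Finite.biUnion b.2 fun j _ => Set.Finite.biUnion (b.1 j).2 fun p _ =>
      (Finset.finite_toSet _).image _
  refine h.subset fun g hg => ?_
  obtain ⟨⟨j, i, k, h⟩, rfl⟩ := (coordEquiv hx).surjective g
  have hne : ((b.1 j).1 i k).coeff h ≠ 0 := by
    rw [← ofCoordMatrix_coordArrow hx]
    exact hg
  have hne' : (b.1 j).1 i k ≠ 0 := fun hc => hne (by rw [hc]; rfl)
  refine Set.mem_biUnion (x := j) (fun hc => hne' (by rw [hc]; rfl))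
    (Set.mem_biUnion (x := (i, k)) hne' ⟨h, ?_, rfl⟩)
  exact Finsupp.mem_support_iff.2 hne

variable (R) [TopologicalSpace C] [TopologicalSpace (Arrow C)] [AmpleGroupoid C]
  [DiscreteTopology (Arrow C)]

/-- The algebra of a discrete groupoid is a direct sum of matrix rings over the group rings of the
isotropy groups. -/
noncomputable def GroupoidAlgebra.matrixEquiv : GroupoidAlgebra R C ≃+* OrbitMatrixSum R x where
  toFun f := coordMatrix hx (finite_support_of_mem f.2)
  invFun b := ⟨ofCoordMatrix hx b, mem_of_finite_support (finite_support_ofCoordMatrix hx b)⟩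
  left_inv f := Subtype.ext <| funext fun g => by
    obtain ⟨⟨j, i, k, h⟩, rfl⟩ := (coordEquiv hx).surjective g
    exact ofCoordMatrix_coordArrow hx _ j i k h
  right_inv b := MatrixSum.ext fun j i k => by
    ext h
    exact ofCoordMatrix_coordArrow hx b j i k h
  map_mul' f k := coordMatrix_convolution hx _ _ _
  map_add' f k := MatrixSum.ext fun j i l => by
    ext h
    rfl

theorem GroupoidAlgebra.matrixEquiv_smul (r : R) (a : GroupoidAlgebra R C) :
    matrixEquiv R hx (r • a) = r • matrixEquiv R hx a :=
  MatrixSum.ext fun j i l => by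
    ext h
    rfl

end Coordinates

end Discrete

/-! ## Isotropy group rings -/

section Isotropy

variable {R : Type*} [CommRing R] {C : Type*} [Groupoid C]

theorem isNoetherianRing_op_isotropyRing_iff (y : C) :
    IsNoetherianRing (IsotropyRing R y)ᵐᵒᵖ ↔ IsNoetherianRing (IsotropyRing R y) :=
  ⟨fun _ => isNoetherianRing_of_ringEquiv _ (monoidAlgebraOpEquiv R (End y)),
    fun _ => isNoetherianRing_of_ringEquiv _ (monoidAlgebraOpEquiv R (End y)).symm⟩

theorem isArtinianRing_op_isotropyRing_iff (y : C) :
    IsArtinianRing (IsotropyRing R y)ᵐᵒᵖ ↔ IsArtinianRing (IsotropyRing R y) :=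
  ⟨fun _ => (monoidAlgebraOpEquiv R (End y)).surjective.isArtinianRing,
    fun _ => (monoidAlgebraOpEquiv R (End y)).symm.surjective.isArtinianRing⟩

/-- The group rings of two isotropy groups in one orbit are isomorphic. -/
noncomputable def isotropyRingEquiv (R : Type*) [CommRing R] {y z : C} (h : z ∈ orbit y) :
    IsotropyRing R y ≃+* IsotropyRing R z :=
  MonoidAlgebra.mapDomainRingEquiv R (asIso h.some).conj

end Isotropy

end AmpleAlg

/-! ### Assembly of the equivalences. -/

theorem theorem5p1 {R : Type*} [CommRing R] [Nontrivial R]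
    {C : Type*} [Groupoid C] [TopologicalSpace C] [TopologicalSpace (Arrow C)] [AmpleGroupoid C]
    {J : Type*} (x : J → C) (hx : ∀ y : C, ∃! j : J, y ∈ orbit (x j)) :
    List.TFAE [
      CategoricallyNoetherian (GroupoidAlgebra R C),
      CategoricallyNoetherian (GroupoidAlgebra R C)ᵐᵒᵖ,
      LocallyNoetherian (GroupoidAlgebra R C),
      LocallyNoetherian (GroupoidAlgebra R C)ᵐᵒᵖ,
      DiscreteTopology (Arrow C) ∧ ∀ y : C, IsNoetherianRing (IsotropyRing R y),
      DiscreteTopology (Arrow C) ∧ ∀ y : C, IsNoetherianRing (IsotropyRing R y)ᵐᵒᵖ,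
      Nonempty (GroupoidAlgebra R C ≃+* OrbitMatrixSum R x) ∧
        ∀ j, IsNoetherianRing (IsotropyRing R (x j)),
      Nonempty (GroupoidAlgebra R C ≃+* OrbitMatrixSum R x) ∧
        ∀ j, IsNoetherianRing (IsotropyRing R (x j))ᵐᵒᵖ,
      (∃ φ : GroupoidAlgebra R C ≃+* OrbitMatrixSum R x, ∀ (r : R) a, φ (r • a) = r • φ a) ∧
        ∀ j, IsNoetherianRing (IsotropyRing R (x j)),
      (∃ φ : GroupoidAlgebra R C ≃+* OrbitMatrixSum R x, ∀ (r : R) a, φ (r • a) = r • φ a) ∧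
        ∀ j, IsNoetherianRing (IsotropyRing R (x j))ᵐᵒᵖ] ∧
    List.TFAE [
      CategoricallyArtinian (GroupoidAlgebra R C),
      CategoricallyArtinian (GroupoidAlgebra R C)ᵐᵒᵖ,
      LocallyArtinian (GroupoidAlgebra R C),
      LocallyArtinian (GroupoidAlgebra R C)ᵐᵒᵖ,
      DiscreteTopology (Arrow C) ∧ ∀ y : C, IsArtinianRing (IsotropyRing R y),
      DiscreteTopology (Arrow C) ∧ ∀ y : C, IsArtinianRing (IsotropyRing R y)ᵐᵒᵖ,
      Nonempty (GroupoidAlgebra R C ≃+* OrbitMatrixSum R x) ∧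
        ∀ j, IsArtinianRing (IsotropyRing R (x j)),
      Nonempty (GroupoidAlgebra R C ≃+* OrbitMatrixSum R x) ∧
        ∀ j, IsArtinianRing (IsotropyRing R (x j))ᵐᵒᵖ,
      (∃ φ : GroupoidAlgebra R C ≃+* OrbitMatrixSum R x, ∀ (r : R) a, φ (r • a) = r • φ a) ∧
        ∀ j, IsArtinianRing (IsotropyRing R (x j)),
      (∃ φ : GroupoidAlgebra R C ≃+* OrbitMatrixSum R x, ∀ (r : R) a, φ (r • a) = r • φ a) ∧
        ∀ j, IsArtinianRing (IsotropyRing R (x j))ᵐᵒᵖ] ∧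
    ∀ y : C, IsArtinianRing (IsotropyRing R y) ∨ IsArtinianRing (IsotropyRing R y)ᵐᵒᵖ →
      Finite (End y) ∧ IsArtinianRing R := by
  have o (j : J) : orbit (x j) := ⟨x j, ⟨𝟙 _⟩⟩
  refine ⟨?_, ?_, ?_⟩
  · tfae_have 1 → 3 := fun h => h.locallyNoetherian
    tfae_have 2 → 4 := fun h => h.locallyNoetherian
    tfae_have 4 → 3 := fun h => h.of_ringEquiv (GroupoidAlgebra.opEquiv R C)
    tfae_have 3 → 5 := by
      intro h
      have : DiscreteTopology (Arrow C) := h.discreteTopology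
      refine ⟨this, fun y => ?_⟩
      obtain ⟨j, hj, -⟩ := hx y
      -- Each orbit contains its representative, so the diagonal matrix unit at `x j` exists, and
      -- its corner maps onto this group ring.
      have : IsNoetherianRing (IsotropyRing R (x j)) := MatrixSum.isNoetherianRing_coefficients
        (h.of_ringEquiv (GroupoidAlgebra.matrixEquiv R hx)) ⟨j, o j⟩
      exact isNoetherianRing_of_ringEquiv _ (isotropyRingEquiv R hj)
    tfae_have 5 ↔ 6 := by simp only [isNoetherianRing_op_isotropyRing_iff]
    tfae_have 7 ↔ 8 := by simp only [isNoetherianRing_op_isotropyRing_iff]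
    tfae_have 9 ↔ 10 := by simp only [isNoetherianRing_op_isotropyRing_iff]
    tfae_have 5 → 9 := by
      rintro ⟨_, h⟩
      exact ⟨⟨GroupoidAlgebra.matrixEquiv R hx, GroupoidAlgebra.matrixEquiv_smul R hx⟩,
        fun j => h (x j)⟩
    tfae_have 9 → 7 := fun ⟨⟨φ, _⟩, h⟩ => ⟨⟨φ⟩, h⟩
    tfae_have 7 → 1 := fun ⟨⟨φ⟩, h⟩ => .of_ringEquiv_matrixSum φ o h
    tfae_have 7 → 2 := fun ⟨⟨φ⟩, h⟩ =>
      .of_ringEquiv_matrixSum ((GroupoidAlgebra.opEquiv R C).trans φ) o h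
    tfae_finish
  · tfae_have 1 → 3 := fun h => h.locallyArtinian
    tfae_have 2 → 4 := fun h => h.locallyArtinian
    tfae_have 4 → 3 := fun h => h.of_ringEquiv (GroupoidAlgebra.opEquiv R C)
    tfae_have 3 → 5 := by
      intro h
      -- The annihilator argument needs ascending chains, so the artinian case passes through
      -- Hopkins–Levitzki.
      have : DiscreteTopology (Arrow C) := h.locallyNoetherian.discreteTopology
      refine ⟨this, fun y => ?_⟩
      obtain ⟨j, hj, -⟩ := hx y
      have : IsArtinianRing (IsotropyRing R (x j)) := MatrixSum.isArtinianRing_coefficients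
        (h.of_ringEquiv (GroupoidAlgebra.matrixEquiv R hx)) ⟨j, o j⟩
      exact (isotropyRingEquiv R hj).surjective.isArtinianRing
    tfae_have 5 ↔ 6 := by simp only [isArtinianRing_op_isotropyRing_iff]
    tfae_have 7 ↔ 8 := by simp only [isArtinianRing_op_isotropyRing_iff]
    tfae_have 9 ↔ 10 := by simp only [isArtinianRing_op_isotropyRing_iff]
    tfae_have 5 → 9 := by
      rintro ⟨_, h⟩
      exact ⟨⟨GroupoidAlgebra.matrixEquiv R hx, GroupoidAlgebra.matrixEquiv_smul R hx⟩,
        fun j => h (x j)⟩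
    tfae_have 9 → 7 := fun ⟨⟨φ, _⟩, h⟩ => ⟨⟨φ⟩, h⟩
    tfae_have 7 → 1 := fun ⟨⟨φ⟩, h⟩ => .of_ringEquiv_matrixSum φ o h
    tfae_have 7 → 2 := fun ⟨⟨φ⟩, h⟩ =>
      .of_ringEquiv_matrixSum ((GroupoidAlgebra.opEquiv R C).trans φ) o h
    tfae_finish
  · intro y h
    rw [isArtinianRing_op_isotropyRing_iff, or_self] at h
    exact ⟨finite_of_isArtinianRing_monoidAlgebra R, isArtinianRing_of_monoidAlgebra (G := End y)⟩
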